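/- Let $d,k\ge 1$ be integers with $k>d/2$ and let $c>1$. A cube is a set $B=\prod_{i=1}^d[a_i,a_i+h)\subseteq[0,1]^d$ with $0<h\le 1$; its volume is $|B|=h^d$. A system $\mathcal B$ of cubes is normal with constant $c$ if every cube $B$ contains a cube $\tilde B\in\mathcal B$ with $|\tilde B|\ge |B|/c$. For $n=N^d$ with $N\in\mathbb N$ let $\Gamma_n=\{(\tau_1/N,\dots,\tau_d/N):\tau_i\in\{0,\dots,N-1\}\}$, let $S_nf=(f(x))_{x\in\Gamma_n}$, and for $y\in\mathbb R^{\Gamma_n}$ let $$\|y\|_{\mathcal B}=\sup_{B\in\mathcal B}\frac{1}{\sqrt{n(B)}}\Bigl|\sum_{x\in\Gamma_n\cap B}y(x)\Bigr|,\qquad n(B)=\#(\Gamma_n\cap B),$$ where terms with $n(B)=0$ are zero. For $1\le q\le\infty$ put $$\vartheta=\begin{cases}\dfrac{k}{2k+d}&\text{if } q\le \dfrac{4k+2d}{d},\\[2mm] \dfrac{k-d/2+d/q}{2k}&\text{if } q\ge\dfrac{4k+2d}{d},\end{cases}\qquad \vartheta'=\frac{2k\vartheta}{d}.$$ Then there are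 constants $C>0$ and $n_0\in\mathbb N$, depending only on $k$, $d$ and $c$, such that for every system of cubes $\mathcal B$ that is normal with constant $c$, every $1\le q\le\infty$, every continuous $f:[0,1]^d\to\mathbb R$ whose weak partial derivatives of order $k$ on $(0,1)^d$ exist and belong to $L^2$, and every $n=N^d\ge n_0$, $$\|f\|_{L^q}\le C\max\Bigl\{\frac{\|S_nf\|_{\mathcal B}^{2\vartheta}}{n^{\vartheta}}\,\|D^kf\|_{L^2}^{1-2\vartheta},\ \frac{\|S_nf\|_{\mathcal B}}{n^{1/2}},\ \frac{\|D^kf\|_{L^2}}{n^{\vartheta'}}\Bigr\}.$$ Here the norms are over the unit cube and $\|D^kf\|_{L^2}$ is the $L^2$-norm of the Euclidean length of the tensor of all partial derivatives of order $k$ of $f$. -/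

import Mathlib

open MeasureTheory
open scoped ENNReal ContDiff

noncomputable section

namespace MultiresolutionNorm

/-- A cube: a nonempty half-open cube `∏ i, [a i, a i + h)` with `0 < h ≤ 1`, contained in
`[0,1]^d`. -/
def IsCube {d : ℕ} (B : Set (Fin d → ℝ)) : Prop :=
  ∃ (a : Fin d → ℝ) (h : ℝ), 0 < h ∧ h ≤ 1 ∧
    B = Set.univ.pi (fun i => Set.Ico (a i) (a i + h)) ∧ B ⊆ Set.Icc 0 1

/-- `𝓑` is a normal system of cubes with normality constant `c`: every cube `B` contains a cube
`B'` of the system with `|B'| ≥ |B| / c`. -/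
structure IsNormalSystem {d : ℕ} (c : ℝ) (𝓑 : Set (Set (Fin d → ℝ))) : Prop where
  one_lt : 1 < c
  isCube : ∀ B ∈ 𝓑, IsCube B
  exists_subset : ∀ B : Set (Fin d → ℝ), IsCube B →
    ∃ B' ∈ 𝓑, B' ⊆ B ∧ volume.real B / c ≤ volume.real B'

/-- The points `(τ₁/N, …, τ_d/N)`, `τ_i = 0, …, N - 1`, of the regular grid `Γ_n` in `[0,1]^d` with
`n = N ^ d` points. Vectors in `ℝ^{Γ_n}` are indexed by `τ`. -/
def gridPoint {d : ℕ} (N : ℕ) (τ : Fin d → Fin N) : Fin d → ℝ :=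
  fun i => ((τ i : ℕ) : ℝ) / (N : ℝ)

/-- The sampling operator `S_n`: evaluation at the points of the grid `Γ_n`, `n = N ^ d`. -/
def sample {d : ℕ} (N : ℕ) (f : (Fin d → ℝ) → ℝ) : (Fin d → Fin N) → ℝ :=
  fun τ => f (gridPoint N τ)

open Classical in
/-- The (indices of the) grid points that lie in `B`; its cardinality is `n(B)`. -/
def gridIn {d : ℕ} (N : ℕ) (B : Set (Fin d → ℝ)) : Finset (Fin d → Fin N) :=
  Finset.univ.filter (fun τ => gridPoint N τ ∈ B)

/-- The normalized local sum `n(B)^{-1/2} |∑_{x ∈ Γ_n ∩ B} y(x)|`, which is zero (as `0 / 0`) if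
`n(B) = 0`. -/
def localSum {d N : ℕ} (y : (Fin d → Fin N) → ℝ) (B : Set (Fin d → ℝ)) : ℝ :=
  |∑ τ ∈ gridIn N B, y τ| / Real.sqrt ((gridIn N B).card : ℝ)

/-- The multiresolution norm `‖y‖_𝓑 = sup_{B ∈ 𝓑} n(B)^{-1/2} |∑_{x ∈ Γ_n ∩ B} y(x)|`. -/
def mrNorm {d N : ℕ} (𝓑 : Set (Set (Fin d → ℝ))) (y : (Fin d → Fin N) → ℝ) : ℝ :=
  ⨆ B : 𝓑, localSum y (B : Set (Fin d → ℝ))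

/-- The supremum in the multiresolution norm is over a bounded set of reals. -/
theorem bddAbove_localSum {d N : ℕ} (𝓑 : Set (Set (Fin d → ℝ))) (y : (Fin d → Fin N) → ℝ) :
    BddAbove (Set.range fun B : 𝓑 => localSum y (B : Set (Fin d → ℝ))) := by
  refine ⟨∑ τ, |y τ|, ?_⟩
  rintro _ ⟨B, rfl⟩
  have h1 : |∑ τ ∈ gridIn N (B : Set (Fin d → ℝ)), y τ| ≤ ∑ τ, |y τ| :=
    (Finset.abs_sum_le_sum_abs _ _).trans
      (Finset.sum_le_sum_of_subset_of_nonneg (Finset.subset_univ _) fun _ _ _ => abs_nonneg _)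
  have h0 : 0 ≤ ∑ τ, |y τ| := Finset.sum_nonneg fun _ _ => abs_nonneg _
  rcases Nat.eq_zero_or_pos (gridIn N (B : Set (Fin d → ℝ))).card with h | h
  · simpa [localSum, h] using h0
  · refine (div_le_self (abs_nonneg _) ?_).trans h1
    rw [Real.one_le_sqrt]
    exact_mod_cast h

/-- The open unit cube `(0,1)^d`. -/
def openCube (d : ℕ) : Set (Fin d → ℝ) :=
  Set.univ.pi fun _ => Set.Ioo 0 1

/-- The family `g`, indexed by `α : Fin k → Fin d`, is the weak `k`-th derivative `D^k f` of `f` on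
`(0,1)^d`: `g α` is the weak partial derivative `∂_{α 0} ⋯ ∂_{α (k-1)} f`, that is,
`∫ f ∂^α φ = (-1)^k ∫ (g α) φ` for all test functions `φ ∈ C_c^∞((0,1)^d)`. -/
def HasWeakDeriv {d : ℕ} (k : ℕ) (f : (Fin d → ℝ) → ℝ)
    (g : (Fin k → Fin d) → (Fin d → ℝ) → ℝ) : Prop :=
  (∀ α, LocallyIntegrableOn (g α) (openCube d)) ∧
  ∀ (α : Fin k → Fin d) (φ : (Fin d → ℝ) → ℝ), ContDiff ℝ ∞ φ → HasCompactSupport φ →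
    tsupport φ ⊆ openCube d →
    ∫ x in openCube d, f x * iteratedFDeriv ℝ k φ x (fun j => Pi.single (α j) (1 : ℝ)) =
      (-1) ^ k * ∫ x in openCube d, g α x * φ x

/-- `‖D^k f‖_{L²}` for `D^k f = g`: the `L²((0,1)^d)` norm of the Euclidean (Frobenius) length of the
tensor `D^k f` of all `k`-th order partial derivatives. -/
def derivL2Norm {d k : ℕ} (g : (Fin k → Fin d) → (Fin d → ℝ) → ℝ) : ℝ :=
  Real.sqrt (∑ α, ∫ x in openCube d, (g α x) ^ 2)

/-- The exponent `ϑ(k, d, q)`: it is `k / (2k + d)` if `q ≤ (4k + 2d) / d` and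
`(k - d/2 + d/q) / (2k)` otherwise (with `d/∞ = 0`). -/
def vartheta (k d : ℕ) (q : ℝ≥0∞) : ℝ :=
  if q ≤ ENNReal.ofReal ((4 * k + 2 * d) / d) then (k : ℝ) / (2 * k + d)
  else (k - (d : ℝ) / 2 + d * (q⁻¹).toReal) / (2 * k)

end MultiresolutionNorm

end

/-!
On a cube `Q` of side `h`, Taylor's formula averaged over the centre of expansion shows that `f`
differs from its polynomial interpolant of degree less than `k` in each coordinate by at most
`C h ^ (k - d / 2) ‖D^k f‖_{L²(Q)}`; the condition `k > d / 2` makes the averaged kernel integrable.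
If `h ≥ κ / N`, normality provides near each interpolation node a cube of `𝓑` of side comparable to
`h` on which the interpolant is nearly constant, so the values at the nodes are bounded by
`C σ h ^ (-d / 2)`, with `σ = ‖S_n f‖_𝓑 / √n`, up to the interpolation error. The sum of these two
terms therefore bounds `|f|` on `Q`.

Increase `σ` to at least a multiple of `‖D^k f‖ / N ^ k` and halve the unit cube repeatedly,
stopping at a cube as soon as its sampling term dominates; this happens before the side falls below
`κ / N`. For the critical exponent `p = (4k + 2d) / d`, a stopping cube contributes at most a
multiple of `σ ^ p h ^ (-2k)` to `∫ |f| ^ p`. A cube `Q` that is split has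
`h ^ (-2k) ≤ ‖D^k f‖²_{L²(Q)} / σ²`, and the left side at least doubles with each generation, so the
contributions add up to a multiple of `σ ^ p (‖D^k f‖ / σ) ^ 2`. The bound on a cube of side
`(σ / ‖D^k f‖) ^ (1 / k)` through a given point controls the supremum. Exponents above `p` follow by
interpolating between the two, those below `p` by monotonicity.
-/

namespace MultiresolutionNorm

section Interpolation

variable {d k : ℕ}

/-- The equidistant nodes `0, 1/k, …, (k - 1)/k` of interpolation on the unit interval. -/
noncomputable def node (k : ℕ) (r : Fin k) : ℝ := (r : ℕ) / (k : ℝ)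

/-- The points with coordinates in `{0, 1/k, …, (k - 1)/k}`, the nodes of tensor product
interpolation on the unit cube. -/
noncomputable def nodePoint (i : Fin d → Fin k) : Fin d → ℝ := fun m => node k (i m)

/-- The tensor product Lagrange basis for the nodes `nodePoint i`. -/
noncomputable def tensorLagrange (i : Fin d → Fin k) (x : Fin d → ℝ) : ℝ :=
  ∏ m, (Lagrange.basis Finset.univ (node k) (i m)).eval (x m)

/-- The polynomial of degree less than `k` in each coordinate that interpolates `f` at the nodes
`nodePoint i`. -/
noncomputable def tensorInterpolant (k : ℕ) (f : (Fin d → ℝ) → ℝ) (x : Fin d → ℝ) : ℝ :=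
  ∑ i : Fin d → Fin k, tensorLagrange i x * f (nodePoint i)

theorem node_injective (k : ℕ) : Function.Injective (node k) := by
  intro r s h
  have hk : (k : ℝ) ≠ 0 := by exact_mod_cast r.pos.ne'
  exact Fin.ext (by exact_mod_cast (div_left_inj' hk).1 h)

theorem nodePoint_nonneg (i : Fin d → Fin k) (m : Fin d) : 0 ≤ nodePoint i m := by
  unfold nodePoint node
  positivity

theorem nodePoint_add_le_one (i : Fin d → Fin k) (m : Fin d) : nodePoint i m + 1 / k ≤ 1 := by
  have hk : (0 : ℝ) < k := by exact_mod_cast (i m).pos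
  rw [nodePoint, node, ← add_div, div_le_one hk]
  exact_mod_cast (i m).isLt

theorem nodePoint_mem_Icc (i : Fin d → Fin k) : nodePoint i ∈ Set.Icc (0 : Fin d → ℝ) 1 := by
  refine ⟨nodePoint_nonneg i, fun m => ?_⟩
  have : (0 : ℝ) ≤ 1 / k := by positivity
  simpa using (le_add_of_nonneg_right this).trans (nodePoint_add_le_one i m)

theorem continuous_tensorLagrange (i : Fin d → Fin k) : Continuous (tensorLagrange i) :=
  continuous_finsetProd _ fun m _ => (Polynomial.continuous _).comp (continuous_apply m)

theorem tensorLagrange_nodePoint (i j : Fin d → Fin k) :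
    tensorLagrange i (nodePoint j) = if i = j then 1 else 0 := by
  unfold tensorLagrange nodePoint
  split_ifs with h
  · subst h
    exact Finset.prod_eq_one fun m _ =>
      Lagrange.eval_basis_self (node_injective k).injOn (Finset.mem_univ _)
  · obtain ⟨m, hm⟩ := Function.ne_iff.1 h
    exact Finset.prod_eq_zero (Finset.mem_univ m)
      (Lagrange.eval_basis_of_ne hm (Finset.mem_univ _))

theorem tensorInterpolant_nodePoint (f : (Fin d → ℝ) → ℝ) (j : Fin d → Fin k) :
    tensorInterpolant k f (nodePoint j) = f (nodePoint j) := by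
  simp [tensorInterpolant, tensorLagrange_nodePoint]

theorem tensorInterpolant_sub (f g : (Fin d → ℝ) → ℝ) (x : Fin d → ℝ) :
    tensorInterpolant k (fun z => f z - g z) x
      = tensorInterpolant k f x - tensorInterpolant k g x := by
  simp only [tensorInterpolant, mul_sub, Finset.sum_sub_distrib]

theorem tensorInterpolant_sum {ι : Type*} (s : Finset ι) (f : ι → (Fin d → ℝ) → ℝ)
    (x : Fin d → ℝ) :
    tensorInterpolant k (fun z => ∑ j ∈ s, f j z) x = ∑ j ∈ s, tensorInterpolant k (f j) x := by
  simp only [tensorInterpolant, Finset.mul_sum]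
  exact Finset.sum_comm

theorem tensorInterpolant_const_mul (c : ℝ) (f : (Fin d → ℝ) → ℝ) (x : Fin d → ℝ) :
    tensorInterpolant k (fun z => c * f z) x = c * tensorInterpolant k f x := by
  simp only [tensorInterpolant, Finset.mul_sum, mul_left_comm]

theorem sum_lagrangeBasis_mul_sub_pow {n : ℕ} (hn : n < k) (y t : ℝ) :
    ∑ r : Fin k, (Lagrange.basis Finset.univ (node k) r).eval t *
      (node k r - y) ^ n = (t - y) ^ n := by
  have h := Lagrange.eq_interpolate (s := Finset.univ) (v := node k)
    (f := (Polynomial.X - Polynomial.C y) ^ n) (node_injective k).injOn (by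
      simpa [Polynomial.degree_pow, Polynomial.degree_X_sub_C] using hn)
  have h_eval := congrArg (Polynomial.eval t) h
  rw [Lagrange.interpolate_apply, Polynomial.eval_finsetSum] at h_eval
  simpa [mul_comm] using h_eval.symm

theorem tensorInterpolant_prod_sub_pow {n : Fin d → ℕ} (hn : ∀ m, n m < k) (x y : Fin d → ℝ) :
    tensorInterpolant k (fun z => ∏ m, (z m - y m) ^ n m) x = ∏ m, (x m - y m) ^ n m := by
  simp_rw [← fun m => sum_lagrangeBasis_mul_sub_pow (hn m) (y m) (x m)]
  rw [Finset.prod_univ_sum]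
  simp only [Fintype.piFinset_univ, tensorInterpolant, tensorLagrange, nodePoint,
    Finset.prod_mul_distrib]

theorem tensorInterpolant_prod_sub {j : ℕ} (hj : j < k) (α : Fin j → Fin d) (x y : Fin d → ℝ) :
    tensorInterpolant k (fun z => ∏ l, (z (α l) - y (α l))) x = ∏ l, (x (α l) - y (α l)) := by
  classical
  have prod_fiber (z : Fin d → ℝ) : ∏ l, (z (α l) - y (α l))
      = ∏ m, (z m - y m) ^ (Finset.univ.filter fun l => α l = m).card := by
    rw [← Finset.prod_fiberwise Finset.univ α]
    refine Finset.prod_congr rfl fun m _ => ?_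
    rw [Finset.prod_congr rfl fun l hl => by rw [(Finset.mem_filter.1 hl).2], Finset.prod_const]
  simp_rw [prod_fiber]
  exact tensorInterpolant_prod_sub_pow
    (fun m => ((Finset.card_le_univ _).trans (by simp)).trans_lt hj) x y

theorem multilinear_apply_eq_sum_single {j : ℕ}
    (M : ContinuousMultilinearMap ℝ (fun _ : Fin j => Fin d → ℝ) ℝ) (m : Fin j → Fin d → ℝ) :
    M m = ∑ α : Fin j → Fin d, M (fun l => Pi.single (α l) 1) * ∏ l, m l (α l) := by
  have expand : m = fun l => ∑ i, m l i • Pi.single i (1 : ℝ) :=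
    funext fun l => pi_eq_sum_univ' (m l)
  conv_lhs => rw [expand, M.map_sum]
  simp only [M.map_smul_univ, smul_eq_mul, mul_comm]

theorem tensorInterpolant_multilinear {j : ℕ} (hj : j < k)
    (M : ContinuousMultilinearMap ℝ (fun _ : Fin j => Fin d → ℝ) ℝ) (x y : Fin d → ℝ) :
    tensorInterpolant k (fun z => M fun _ => z - y) x = M fun _ => x - y := by
  have expand (v : Fin d → ℝ) := multilinear_apply_eq_sum_single M fun _ => v
  simp only [expand, tensorInterpolant_sum, tensorInterpolant_const_mul, Pi.sub_apply,
    tensorInterpolant_prod_sub hj]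

theorem exists_sum_abs_tensorLagrange_le (d k : ℕ) :
    ∃ K : ℝ, 0 ≤ K ∧ ∀ x ∈ Set.Icc (0 : Fin d → ℝ) 1,
      ∑ i : Fin d → Fin k, |tensorLagrange i x| ≤ K := by
  obtain ⟨K, hK⟩ := (isCompact_Icc (a := (0 : Fin d → ℝ)) (b := 1)).exists_bound_of_continuousOn
    (f := fun x => ∑ i : Fin d → Fin k, |tensorLagrange i x|)
    (continuous_finsetSum _ fun i _ => (continuous_tensorLagrange i).abs).continuousOn
  exact ⟨K, (norm_nonneg _).trans (hK 0 ⟨le_rfl, zero_le_one⟩),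
    fun x hx => (le_abs_self _).trans (hK x hx)⟩

theorem exists_sum_abs_tensorLagrange_sub_le (d k : ℕ) {η : ℝ} (hη : 0 < η) :
    ∃ δ : ℝ, 0 < δ ∧ ∀ x ∈ Set.Icc (0 : Fin d → ℝ) 1, ∀ y ∈ Set.Icc (0 : Fin d → ℝ) 1,
      dist x y ≤ δ → ∑ i : Fin d → Fin k, |tensorLagrange i x - tensorLagrange i y| ≤ η := by
  have hcont : Continuous fun x : Fin d → ℝ => fun i : Fin d → Fin k => tensorLagrange i x :=
    continuous_pi continuous_tensorLagrange
  obtain ⟨δ, hδ, h⟩ := Metric.uniformContinuousOn_iff_le.1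
    ((isCompact_Icc (a := (0 : Fin d → ℝ)) (b := 1)).uniformContinuousOn_of_continuous
      hcont.continuousOn) (η / (Fintype.card (Fin d → Fin k) + 1)) (by positivity)
  refine ⟨δ, hδ, fun x hx y hy hxy => ?_⟩
  calc ∑ i : Fin d → Fin k, |tensorLagrange i x - tensorLagrange i y|
      ≤ ∑ _i : Fin d → Fin k, η / (Fintype.card (Fin d → Fin k) + 1) :=
        Finset.sum_le_sum fun i _ => (dist_le_pi_dist _ _ i).trans (h x hx y hy hxy)
    _ = η * (Fintype.card (Fin d → Fin k) / (Fintype.card (Fin d → Fin k) + 1)) := by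
        rw [Finset.sum_const, Finset.card_univ, nsmul_eq_mul]
        ring
    _ ≤ η := mul_le_of_le_one_right hη.le ((div_le_one (by positivity)).2 (by linarith))

theorem abs_tensorInterpolant_le {f : (Fin d → ℝ) → ℝ} {M : ℝ}
    (hM : ∀ i : Fin d → Fin k, |f (nodePoint i)| ≤ M) (x : Fin d → ℝ) :
    |tensorInterpolant k f x| ≤ (∑ i : Fin d → Fin k, |tensorLagrange i x|) * M := by
  rw [Finset.sum_mul]
  refine (Finset.abs_sum_le_sum_abs _ _).trans (Finset.sum_le_sum fun i _ => ?_)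
  rw [abs_mul]
  gcongr
  exact hM i

theorem abs_tensorInterpolant_sub_le {f : (Fin d → ℝ) → ℝ} {M : ℝ}
    (hM : ∀ i : Fin d → Fin k, |f (nodePoint i)| ≤ M) (x y : Fin d → ℝ) :
    |tensorInterpolant k f x - tensorInterpolant k f y|
      ≤ (∑ i : Fin d → Fin k, |tensorLagrange i x - tensorLagrange i y|) * M := by
  rw [tensorInterpolant, tensorInterpolant, ← Finset.sum_sub_distrib, Finset.sum_mul]
  refine (Finset.abs_sum_le_sum_abs _ _).trans (Finset.sum_le_sum fun i _ => ?_)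
  rw [← sub_mul, abs_mul]
  gcongr
  exact hM i

end Interpolation

section Taylor

/-- The bound `∫₀¹ (1 - t)^(k - 1) H(y + t(x - y)) dt` for the remainder at `x` of Taylor's formula
of order `k` about `y`, where `H` is the norm of the `k`-th derivative; the factor `1 / (k - 1)!` is
dropped. -/
noncomputable def taylorRemainder {E : Type*} [AddCommGroup E] [Module ℝ E] (k : ℕ)
    (H : E → ℝ≥0∞) (x y : E) : ℝ≥0∞ :=
  ∫⁻ t in Set.Ioo (0 : ℝ) 1, ENNReal.ofReal ((1 - t) ^ (k - 1)) * H (y + t • (x - y))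

theorem enorm_sub_taylor_le {E F : Type*} [NormedAddCommGroup E] [NormedSpace ℝ E]
    [NormedAddCommGroup F] [NormedSpace ℝ F] [CompleteSpace F] {k : ℕ} (hk : 0 < k) {u : E → F}
    (hu : ContDiff ℝ k u) {x y : E} (hxy : ‖x - y‖ ≤ 1) :
    ‖u x - ∑ j ∈ Finset.range k, (j.factorial : ℝ)⁻¹ • iteratedFDeriv ℝ j u y fun _ => x - y‖ₑ
      ≤ taylorRemainder k (fun w => ‖iteratedFDeriv ℝ k u w‖ₑ) x y := by
  obtain ⟨n, rfl⟩ := Nat.exists_eq_add_one.2 hk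
  have taylor := map_add_eq_sum_add_integral_iteratedFDeriv (f := u) (x := y) (y := x - y)
    (n := n) fun t _ => hu.contDiffAt
  rw [add_sub_cancel] at taylor
  have factorial_inv_le_one : ‖(n.factorial : ℝ)⁻¹‖ₑ ≤ 1 := by
    rw [← ofReal_norm, ENNReal.ofReal_le_one, norm_inv, RCLike.norm_natCast]
    exact inv_le_one_of_one_le₀ (by exact_mod_cast n.factorial_pos)
  rw [taylor, add_sub_cancel_left, enorm_smul, intervalIntegral.integral_of_le zero_le_one,
    integral_Ioc_eq_integral_Ioo]
  refine (mul_le_of_le_one_left' factorial_inv_le_one).trans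
    ((enorm_integral_le_lintegral_enorm _).trans ?_)
  refine setLIntegral_mono' measurableSet_Ioo fun t ht => ?_
  rw [enorm_smul, Real.enorm_of_nonneg (pow_nonneg (sub_nonneg.2 ht.2.le) n)]
  simp only [← ofReal_norm]
  refine mul_le_mul' le_rfl (ENNReal.ofReal_le_ofReal ?_)
  refine ((iteratedFDeriv ℝ (n + 1) u _).le_opNorm _).trans ?_
  exact mul_le_of_le_one_right (norm_nonneg _)
    (Finset.prod_le_one (fun _ _ => norm_nonneg _) fun _ _ => hxy)

theorem lintegral_le_sqrt_lintegral_sq {α : Type*} [MeasurableSpace α] {μ : Measure α}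
    (hμ : μ Set.univ ≤ 1) {H : α → ℝ≥0∞} (hH : AEMeasurable H μ) :
    ∫⁻ y, H y ∂μ ≤ (∫⁻ y, H y ^ 2 ∂μ) ^ (1 / 2 : ℝ) := by
  have holder := ENNReal.lintegral_mul_le_Lp_mul_Lq μ Real.HolderConjugate.two_two hH
    (aemeasurable_const (b := (1 : ℝ≥0∞)))
  simp only [Pi.mul_apply, mul_one, lintegral_const, ENNReal.rpow_ofNat, one_pow, one_mul] at holder
  exact holder.trans (mul_le_of_le_one_right' (ENNReal.rpow_le_one hμ (by norm_num)))

variable {d : ℕ}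

theorem volume_Icc_zero_one (d : ℕ) : volume (Set.Icc (0 : Fin d → ℝ) 1) = 1 := by
  simp [Real.volume_Icc_pi]

theorem lintegral_comp_add_smul {H : (Fin d → ℝ) → ℝ≥0∞} (hH : Measurable H) (b : Fin d → ℝ)
    {s : ℝ} (hs : 0 < s) :
    ∫⁻ y, H (b + s • y) = ENNReal.ofReal (s ^ d)⁻¹ * ∫⁻ z, H z := by
  have map_smul : ∫⁻ y, H (b + s • y) = ∫⁻ w, H (b + w) ∂(Measure.map (s • ·) volume) := by
    rw [lintegral_map (f := fun w => H (b + w)) (by fun_prop) (measurable_const_smul s)]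
  rw [map_smul, Measure.map_addHaar_smul volume hs.ne', lintegral_smul_measure,
    lintegral_add_left_eq_self (μ := volume) H b, Module.finrank_fin_fun,
    abs_of_nonneg (by positivity), smul_eq_mul]

/-- The integral `∫₀¹ (1 - t)^(k - 1 - d/2) dt`, the constant that arises from averaging the
remainder of Taylor's formula over the centre of expansion. -/
noncomputable def kernelConst (k d : ℕ) : ℝ≥0∞ :=
  ∫⁻ t in Set.Ioo (0 : ℝ) 1,
    ENNReal.ofReal ((1 - t) ^ (k - 1)) * ENNReal.ofReal ((1 - t) ^ d)⁻¹ ^ (1 / 2 : ℝ)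

theorem kernelConst_lt_top {k : ℕ} (hk : (d : ℝ) / 2 < k) : kernelConst k d < ⊤ := by
  have hk0 : 1 ≤ k := by
    have : (0 : ℝ) < k := lt_of_le_of_lt (by positivity) hk
    exact_mod_cast this
  have integrable : IntervalIntegrable (fun t : ℝ => (1 - t) ^ ((k : ℝ) - 1 - d / 2)) volume 0 1 :=
    by simpa using ((intervalIntegral.intervalIntegrable_rpow' (a := 0) (b := 1)
      (by linarith : -1 < (k : ℝ) - 1 - d / 2)).comp_sub_left 1).symm
  rw [intervalIntegrable_iff_integrableOn_Ioo_of_le zero_le_one] at integrable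
  refine lt_of_eq_of_lt (setLIntegral_congr_fun measurableSet_Ioo fun t ht => ?_)
    integrable.lintegral_lt_top
  have hs : 0 < 1 - t := sub_pos.2 ht.2
  rw [ENNReal.ofReal_rpow_of_nonneg (by positivity) (by norm_num),
    ← ENNReal.ofReal_mul (by positivity), ← Real.rpow_natCast, ← Real.rpow_natCast,
    ← Real.rpow_neg hs.le, ← Real.rpow_mul hs.le, ← Real.rpow_add hs]
  congr 2
  push_cast [hk0]
  ring

theorem setLIntegral_comp_add_smul_sub_le {H : (Fin d → ℝ) → ℝ≥0∞} (hH : Measurable H)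
    {x : Fin d → ℝ} (hx : x ∈ Set.Icc (0 : Fin d → ℝ) 1) {t : ℝ} (ht : t ∈ Set.Ioo (0 : ℝ) 1) :
    ∫⁻ y in Set.Icc (0 : Fin d → ℝ) 1, H (y + t • (x - y))
      ≤ ENNReal.ofReal ((1 - t) ^ d)⁻¹ * ∫⁻ w in Set.Icc (0 : Fin d → ℝ) 1, H w := by
  have hs : 0 < 1 - t := sub_pos.2 ht.2
  rw [← lintegral_indicator measurableSet_Icc H,
    ← lintegral_comp_add_smul (hH.indicator measurableSet_Icc) (t • x) hs,
    ← lintegral_indicator measurableSet_Icc]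
  refine lintegral_mono (Set.indicator_le fun y hy => ?_)
  have segment : y + t • (x - y) = t • x + (1 - t) • y := by
    rw [smul_sub, sub_smul, one_smul]
    abel
  rw [Set.indicator_of_mem (convex_Icc (0 : Fin d → ℝ) 1 hx hy ht.1.le hs.le (by ring)), segment]

theorem measurable_taylorRemainder (k : ℕ) {H : (Fin d → ℝ) → ℝ≥0∞} (hH : Measurable H)
    (x : Fin d → ℝ) : Measurable (taylorRemainder k H x) :=
  Measurable.lintegral_prod_right' (f := fun p : (Fin d → ℝ) × ℝ =>
    ENNReal.ofReal ((1 - p.2) ^ (k - 1)) * H (p.1 + p.2 • (x - p.1))) (by fun_prop)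

theorem lintegral_taylorRemainder_le (k : ℕ) {H : (Fin d → ℝ) → ℝ≥0∞} (hH : Measurable H)
    {x : Fin d → ℝ} (hx : x ∈ Set.Icc (0 : Fin d → ℝ) 1) :
    ∫⁻ y in Set.Icc (0 : Fin d → ℝ) 1, taylorRemainder k H x y
      ≤ kernelConst k d * (∫⁻ w in Set.Icc (0 : Fin d → ℝ) 1, H w ^ 2) ^ (1 / 2 : ℝ) := by
  simp only [taylorRemainder]
  rw [lintegral_lintegral_swap (by fun_prop), kernelConst, ← lintegral_mul_const _ (by fun_prop)]
  refine setLIntegral_mono' measurableSet_Ioo fun t ht => ?_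
  rw [lintegral_const_mul _ (by fun_prop), mul_assoc,
    ← ENNReal.mul_rpow_of_nonneg _ _ (by norm_num : (0 : ℝ) ≤ 1 / 2)]
  gcongr
  refine (lintegral_le_sqrt_lintegral_sq (by simp [volume_Icc_zero_one]) (by fun_prop)).trans ?_
  gcongr
  exact setLIntegral_comp_add_smul_sub_le (hH.pow_const 2) hx ht

theorem norm_sub_le_one_of_mem_Icc {x y : Fin d → ℝ} (hx : x ∈ Set.Icc (0 : Fin d → ℝ) 1)
    (hy : y ∈ Set.Icc (0 : Fin d → ℝ) 1) : ‖x - y‖ ≤ 1 := by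
  refine (pi_norm_le_iff_of_nonneg zero_le_one).2 fun i => abs_sub_le_iff.2 ⟨?_, ?_⟩
  · simpa using sub_le_sub (hx.2 i) (hy.1 i)
  · simpa using sub_le_sub (hy.2 i) (hx.1 i)

theorem enorm_sub_tensorInterpolant_le_taylorRemainder {k : ℕ} (hk : 0 < k) {u : (Fin d → ℝ) → ℝ}
    (hu : ContDiff ℝ k u) {x y : Fin d → ℝ} (hx : x ∈ Set.Icc (0 : Fin d → ℝ) 1)
    (hy : y ∈ Set.Icc (0 : Fin d → ℝ) 1) :
    ‖u x - tensorInterpolant k u x‖ₑ ≤ taylorRemainder k (fun w => ‖iteratedFDeriv ℝ k u w‖ₑ) x y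
      + ∑ i : Fin d → Fin k, ‖tensorLagrange i x‖ₑ *
        taylorRemainder k (fun w => ‖iteratedFDeriv ℝ k u w‖ₑ) (nodePoint i) y := by
  set P : (Fin d → ℝ) → ℝ := fun z =>
    ∑ j ∈ Finset.range k, (j.factorial : ℝ)⁻¹ * iteratedFDeriv ℝ j u y fun _ => z - y
  have taylor (z) (hz : z ∈ Set.Icc (0 : Fin d → ℝ) 1) :
      ‖u z - P z‖ₑ ≤ taylorRemainder k (fun w => ‖iteratedFDeriv ℝ k u w‖ₑ) z y :=
    enorm_sub_taylor_le hk hu (norm_sub_le_one_of_mem_Icc hz hy)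
  have reproduced : tensorInterpolant k P x = P x := by
    simp only [P, tensorInterpolant_sum, tensorInterpolant_const_mul]
    exact Finset.sum_congr rfl fun j hj => by
      rw [tensorInterpolant_multilinear (Finset.mem_range.1 hj)]
  have split : u x - tensorInterpolant k u x
      = (u x - P x) - tensorInterpolant k (fun z => u z - P z) x := by
    rw [tensorInterpolant_sub, reproduced]
    ring
  rw [split]
  refine enorm_sub_le.trans (add_le_add (taylor x hx) ?_)
  refine (enorm_sum_le _ _).trans (Finset.sum_le_sum fun i _ => ?_)
  rw [enorm_mul]
  gcongr
  exact taylor _ (nodePoint_mem_Icc i)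

theorem enorm_sub_tensorInterpolant_le {k : ℕ} (hk : 0 < k) {u : (Fin d → ℝ) → ℝ}
    (hu : ContDiff ℝ k u) {x : Fin d → ℝ} (hx : x ∈ Set.Icc (0 : Fin d → ℝ) 1) :
    ‖u x - tensorInterpolant k u x‖ₑ
      ≤ (1 + ∑ i : Fin d → Fin k, ‖tensorLagrange i x‖ₑ) * (kernelConst k d *
        (∫⁻ w in Set.Icc (0 : Fin d → ℝ) 1, ‖iteratedFDeriv ℝ k u w‖ₑ ^ 2) ^ (1 / 2 : ℝ)) := by
  have hH : Measurable fun w => ‖iteratedFDeriv ℝ k u w‖ₑ :=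
    (hu.continuous_iteratedFDeriv le_rfl).enorm.measurable
  have averaged := setLIntegral_mono' (μ := volume) measurableSet_Icc fun y hy =>
    enorm_sub_tensorInterpolant_le_taylorRemainder hk hu hx hy
  rw [setLIntegral_const, volume_Icc_zero_one, mul_one,
    lintegral_add_left (measurable_taylorRemainder k hH x),
    lintegral_finsetSum _ fun i _ => (measurable_taylorRemainder k hH _).const_mul _] at averaged
  refine averaged.trans ?_
  rw [add_mul, one_mul, Finset.sum_mul]
  refine add_le_add (lintegral_taylorRemainder_le k hH hx) (Finset.sum_le_sum fun i _ => ?_)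
  rw [lintegral_const_mul _ (measurable_taylorRemainder k hH _)]
  gcongr
  exact lintegral_taylorRemainder_le k hH (nodePoint_mem_Icc i)

end Taylor

section Mollification

open Filter Topology ContinuousLinearMap
open scoped Convolution

section NormedSpace

variable {E F G H : Type*} [NormedAddCommGroup E] [NormedSpace ℝ E] [NormedAddCommGroup F]
  [NormedSpace ℝ F] [NormedAddCommGroup G] [NormedSpace ℝ G] [NormedAddCommGroup H]
  [NormedSpace ℝ H]

theorem iteratedFDeriv_comp_add_smul {k : ℕ} {u : G → F} (hu : ContDiff ℝ k u) (b : G) (s : ℝ)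
    (x : G) :
    iteratedFDeriv ℝ k (fun z => u (b + s • z)) x = s ^ k • iteratedFDeriv ℝ k u (b + s • x) := by
  simp only [iteratedFDeriv_comp_const_smul (f := fun z => u (b + z)) s (by fun_prop),
    iteratedFDeriv_comp_add_left]

theorem iteratedFDeriv_convolution_right_apply [MeasurableSpace G] [BorelSpace G] {μ : Measure G}
    [SFinite μ] [μ.IsAddLeftInvariant] (L : E →L[ℝ] F →L[ℝ] H) {f : G → E} {φ : G → F}
    (hf : LocallyIntegrable f μ) (hφ : ContDiff ℝ ∞ φ) (hc : HasCompactSupport φ) (k : ℕ) (x : G)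
    (m : Fin k → G) :
    iteratedFDeriv ℝ k (f ⋆[L, μ] φ) x m
      = (f ⋆[L, μ] fun y => iteratedFDeriv ℝ k φ y m) x := by
  induction k generalizing x with
  | zero => simp
  | succ k ih =>
    set ψ : G → F := fun y => iteratedFDeriv ℝ k φ y (Fin.tail m)
    have smooth_ψ : ContDiff ℝ 1 ψ :=
      (ContinuousMultilinearMap.apply ℝ (fun _ => G) F (Fin.tail m)).contDiff.comp
        (hφ.iteratedFDeriv_right (by exact_mod_cast le_top))
    have compact_ψ : HasCompactSupport ψ :=
      (hc.iteratedFDeriv (𝕜 := ℝ) k).comp_left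
        (map_zero (ContinuousMultilinearMap.apply ℝ (fun _ => G) F (Fin.tail m)))
    have smooth_conv : ContDiff ℝ ∞ (f ⋆[L, μ] φ) := hc.contDiff_convolution_right L hf hφ
    rw [iteratedFDeriv_succ_apply_left, ← fderiv_continuousMultilinear_apply_const_apply
      (smooth_conv.differentiable_iteratedFDeriv (by exact_mod_cast WithTop.coe_lt_top _) x),
      funext fun y => ih y (Fin.tail m),
      (compact_ψ.hasFDerivAt_convolution_right L hf smooth_ψ x).fderiv,
      convolution_precompR_apply L hf (compact_ψ.fderiv ℝ) (smooth_ψ.continuous_fderiv one_ne_zero)]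
    congr 1
    ext y
    rw [iteratedFDeriv_succ_apply_left, ← fderiv_continuousMultilinear_apply_const_apply
      (hφ.differentiable_iteratedFDeriv (by exact_mod_cast WithTop.coe_lt_top _) y)]

end NormedSpace

variable {d k : ℕ} {f : (Fin d → ℝ) → ℝ} {g : (Fin k → Fin d) → (Fin d → ℝ) → ℝ}

theorem measurableSet_openCube : MeasurableSet (openCube d) :=
  MeasurableSet.univ_pi fun _ => measurableSet_Ioo

theorem HasWeakDeriv.aestronglyMeasurable (hw : HasWeakDeriv k f g) (α : Fin k → Fin d) :
    AEStronglyMeasurable (g α) (volume.restrict (openCube d)) :=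
  (hw.1 α).aestronglyMeasurable

theorem HasWeakDeriv.iteratedFDeriv_convolution (hw : HasWeakDeriv k f g)
    (hf : LocallyIntegrable f) {φ : (Fin d → ℝ) → ℝ} (hφ : ContDiff ℝ ∞ φ)
    (hc : HasCompactSupport φ) {w : Fin d → ℝ}
    (hsupp : tsupport (fun t => φ (w - t)) ⊆ openCube d) (α : Fin k → Fin d) :
    iteratedFDeriv ℝ k (f ⋆[lsmul ℝ ℝ, volume] φ) w (fun j => Pi.single (α j) 1)
      = ∫ t in openCube d, g α t * φ (w - t) := by
  set ψ : (Fin d → ℝ) → ℝ := fun t => φ (w - t)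
  have smooth_ψ : ContDiff ℝ ∞ ψ := hφ.comp (contDiff_const.sub contDiff_id)
  have compact_ψ : HasCompactSupport ψ := hc.comp_homeomorph (Homeomorph.subLeft w)
  have iteratedFDeriv_φ (t : Fin d → ℝ) :
      iteratedFDeriv ℝ k φ (w - t) = (-1 : ℝ) ^ k • iteratedFDeriv ℝ k ψ t := by
    have reflected := iteratedFDeriv_comp_add_smul (k := k) (u := ψ)
      (smooth_ψ.of_le (by exact_mod_cast le_top)) w (-1) (w - t)
    simpa [ψ] using reflected
  have vanishes (t : Fin d → ℝ) (ht : t ∉ openCube d) : iteratedFDeriv ℝ k ψ t = 0 :=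
    Function.notMem_support.1 fun h => ht (hsupp (support_iteratedFDeriv_subset k h))
  rw [iteratedFDeriv_convolution_right_apply _ hf hφ hc, convolution_def,
    ← setIntegral_eq_integral_of_forall_compl_eq_zero (s := openCube d)
      fun t ht => by simp [iteratedFDeriv_φ, vanishes t ht]]
  simp only [iteratedFDeriv_φ, lsmul_apply, smul_apply, smul_eq_mul,
    mul_left_comm (f _), integral_const_mul]
  rw [hw.2 α ψ smooth_ψ compact_ψ hsupp, ← mul_assoc, ← mul_pow]
  simp [ψ]

theorem enorm_integral_mul_sq_le {X : Type*} [MeasurableSpace X] {μ : Measure X} {g ψ : X → ℝ}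
    (hg : AEStronglyMeasurable g μ) (hψ : Measurable ψ) (hψ1 : ∫⁻ t, ‖ψ t‖ₑ ∂μ ≤ 1) :
    ‖∫ t, g t * ψ t ∂μ‖ₑ ^ 2 ≤ ∫⁻ t, ‖g t‖ₑ ^ 2 * ‖ψ t‖ₑ ∂μ := by
  set ν := μ.withDensity fun t => ‖ψ t‖ₑ
  have lintegral_ν {H : X → ℝ≥0∞} (hH : AEMeasurable H μ) :
      ∫⁻ t, H t ∂ν = ∫⁻ t, H t * ‖ψ t‖ₑ ∂μ := by
    rw [lintegral_withDensity_eq_lintegral_mul₀ hψ.enorm.aemeasurable hH]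
    simp only [Pi.mul_apply, mul_comm]
  have jensen : ∫⁻ t, ‖g t‖ₑ ∂ν ≤ (∫⁻ t, ‖g t‖ₑ ^ 2 ∂ν) ^ (1 / 2 : ℝ) :=
    lintegral_le_sqrt_lintegral_sq (by simpa [ν] using hψ1)
      (hg.enorm.mono_ac (withDensity_absolutelyContinuous _ _))
  calc ‖∫ t, g t * ψ t ∂μ‖ₑ ^ 2 ≤ (∫⁻ t, ‖g t‖ₑ ∂ν) ^ 2 := by
        rw [lintegral_ν hg.enorm]
        gcongr
        simpa only [enorm_mul] using enorm_integral_le_lintegral_enorm fun t => g t * ψ t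
    _ ≤ ((∫⁻ t, ‖g t‖ₑ ^ 2 ∂ν) ^ (1 / 2 : ℝ)) ^ 2 := by gcongr
    _ = ∫⁻ t, ‖g t‖ₑ ^ 2 * ‖ψ t‖ₑ ∂μ := by
        rw [← ENNReal.rpow_natCast, ← ENNReal.rpow_mul, lintegral_ν (hg.enorm.pow_const 2)]
        norm_num

theorem enorm_sq_le_sum_single (M : (Fin d → ℝ) [×k]→L[ℝ] ℝ) :
    ‖M‖ₑ ^ 2 ≤ (d : ℝ≥0∞) ^ k * ∑ α : Fin k → Fin d, ‖M fun j => Pi.single (α j) 1‖ₑ ^ 2 := by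
  set S := ∑ α : Fin k → Fin d, ‖M fun j => Pi.single (α j) 1‖₊
  have norm_le : ‖M‖₊ ≤ S := by
    refine M.opNNNorm_le_iff.2 fun m => ?_
    rw [multilinear_apply_eq_sum_single, Finset.sum_mul]
    refine nnnorm_sum_le_of_le _ fun α _ => ?_
    rw [nnnorm_mul, nnnorm_prod]
    gcongr with j
    exact nnnorm_le_pi_nnnorm _ _
  have cauchy_schwarz := (pow_le_pow_left₀ zero_le norm_le 2).trans sq_sum_le_card_mul_sum_sq
  simp only [Finset.card_univ, Fintype.card_fun, Fintype.card_fin] at cauchy_schwarz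
  simpa only [enorm_eq_nnnorm] using mod_cast cauchy_schwarz

/-- The half-open cube `∏ i, [a i, a i + h)`. -/
def cube (a : Fin d → ℝ) (h : ℝ) : Set (Fin d → ℝ) :=
  Set.univ.pi fun i => Set.Ico (a i) (a i + h)

theorem measurableSet_cube (a : Fin d → ℝ) (h : ℝ) : MeasurableSet (cube a h) :=
  MeasurableSet.univ_pi fun _ => measurableSet_Ico

/-- `cube a h` is nondegenerate and contained in the unit cube. -/
structure IsSubcube (a : Fin d → ℝ) (h : ℝ) : Prop where
  pos : 0 < h
  nonneg : ∀ i, 0 ≤ a i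
  add_le_one : ∀ i, a i + h ≤ 1

/-- The measure with density `|D^k f|²` on the open unit cube, where `g = D^k f`. -/
noncomputable def derivMeasure (g : (Fin k → Fin d) → (Fin d → ℝ) → ℝ) : Measure (Fin d → ℝ) :=
  (volume.restrict (openCube d)).withDensity fun z => ∑ α, ‖g α z‖ₑ ^ 2

theorem enorm_iteratedFDeriv_convolution_sq_le (hw : HasWeakDeriv k f g)
    (hf : LocallyIntegrable f) {φ : (Fin d → ℝ) → ℝ} (hφ : ContDiff ℝ ∞ φ)
    (hc : HasCompactSupport φ) (hφ1 : ∫⁻ t, ‖φ t‖ₑ ≤ 1) {w : Fin d → ℝ}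
    (hsupp : tsupport (fun t => φ (w - t)) ⊆ openCube d) :
    ‖iteratedFDeriv ℝ k (f ⋆[lsmul ℝ ℝ, volume] φ) w‖ₑ ^ 2
      ≤ (d : ℝ≥0∞) ^ k * ∫⁻ t in openCube d, (∑ α, ‖g α t‖ₑ ^ 2) * ‖φ (w - t)‖ₑ := by
  have measurable_φ : Measurable φ := hφ.continuous.measurable
  refine (enorm_sq_le_sum_single _).trans ?_
  simp_rw [hw.iteratedFDeriv_convolution hf hφ hc hsupp, Finset.sum_mul]
  rw [lintegral_finsetSum' (f := fun α t => ‖g α t‖ₑ ^ 2 * ‖φ (w - t)‖ₑ) _ fun α _ =>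
    ((hw.aestronglyMeasurable α).enorm.pow_const 2).mul (by fun_prop)]
  gcongr with α
  refine enorm_integral_mul_sq_le (hw.aestronglyMeasurable α) (by fun_prop) ?_
  calc ∫⁻ t in openCube d, ‖φ (w - t)‖ₑ ≤ ∫⁻ t, ‖φ (w - t)‖ₑ := setLIntegral_le_lintegral _ _
    _ = ∫⁻ t, ‖φ t‖ₑ := lintegral_sub_left_eq_self (fun t => ‖φ t‖ₑ) w
    _ ≤ 1 := hφ1

theorem setLIntegral_enorm_comp_sub_le_indicator {φ : (Fin d → ℝ) → ℝ} (hφ : Measurable φ)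
    (hφ1 : ∫⁻ t, ‖φ t‖ₑ ≤ 1) {b : Fin d → ℝ} {s : ℝ} (hs : 0 < s) {Q : Set (Fin d → ℝ)}
    (hsupp : ∀ w ∈ Set.Icc (0 : Fin d → ℝ) 1, Function.support (fun t => φ (b + s • w - t)) ⊆ Q)
    (t : Fin d → ℝ) :
    ∫⁻ w in Set.Icc (0 : Fin d → ℝ) 1, ‖φ (b + s • w - t)‖ₑ
      ≤ Q.indicator (fun _ => ENNReal.ofReal (s ^ d)⁻¹) t := by
  by_cases ht : t ∈ Q
  · calc ∫⁻ w in Set.Icc (0 : Fin d → ℝ) 1, ‖φ (b + s • w - t)‖ₑ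
        ≤ ∫⁻ w, ‖φ (b - t + s • w)‖ₑ := by
          simp only [sub_add_eq_add_sub]
          exact setLIntegral_le_lintegral _ _
      _ ≤ ENNReal.ofReal (s ^ d)⁻¹ := by
          rw [lintegral_comp_add_smul (H := fun z => ‖φ z‖ₑ) (by fun_prop) _ hs]
          exact mul_le_of_le_one_right' hφ1
      _ = _ := by rw [Set.indicator_of_mem ht]
  · have vanishes (w) (hw : w ∈ Set.Icc (0 : Fin d → ℝ) 1) : φ (b + s • w - t) = 0 :=
      Function.notMem_support.1 fun h => ht (hsupp w hw h)
    rw [setLIntegral_congr_fun measurableSet_Icc fun w hw => by rw [vanishes w hw]]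
    simp

theorem lintegral_iteratedFDeriv_convolution_sq_le (hw : HasWeakDeriv k f g)
    (hf : LocallyIntegrable f) {φ : (Fin d → ℝ) → ℝ} (hφ : ContDiff ℝ ∞ φ)
    (hc : HasCompactSupport φ) (hφ1 : ∫⁻ t, ‖φ t‖ₑ ≤ 1) {b : Fin d → ℝ} {s : ℝ} (hs : 0 < s)
    {Q : Set (Fin d → ℝ)} (hQ : MeasurableSet Q)
    (hsupp : ∀ w ∈ Set.Icc (0 : Fin d → ℝ) 1,
      tsupport (fun t => φ (b + s • w - t)) ⊆ Q ∩ openCube d) :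
    ∫⁻ w in Set.Icc (0 : Fin d → ℝ) 1,
        ‖iteratedFDeriv ℝ k (f ⋆[lsmul ℝ ℝ, volume] φ) (b + s • w)‖ₑ ^ 2
      ≤ (d : ℝ≥0∞) ^ k * (ENNReal.ofReal (s ^ d)⁻¹ * derivMeasure g Q) := by
  have measurable_φ : Measurable φ := hφ.continuous.measurable
  set G : (Fin d → ℝ) → ℝ≥0∞ := fun t => ∑ α, ‖g α t‖ₑ ^ 2
  have measurable_G : AEMeasurable G (volume.restrict (openCube d)) := by
    refine Finset.aemeasurable_fun_sum _ fun α _ => (hw.aestronglyMeasurable α).enorm.pow_const 2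
  calc _ ≤ ∫⁻ w in Set.Icc (0 : Fin d → ℝ) 1,
        (d : ℝ≥0∞) ^ k * ∫⁻ t in openCube d, G t * ‖φ (b + s • w - t)‖ₑ :=
        setLIntegral_mono' measurableSet_Icc fun w hw' =>
          enorm_iteratedFDeriv_convolution_sq_le hw hf hφ hc hφ1
            ((hsupp w hw').trans Set.inter_subset_right)
    _ = (d : ℝ≥0∞) ^ k * ∫⁻ t in openCube d,
        G t * ∫⁻ w in Set.Icc (0 : Fin d → ℝ) 1, ‖φ (b + s • w - t)‖ₑ := by
      rw [lintegral_const_mul' _ _ (by finiteness), lintegral_lintegral_swap]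
      · congr! 3 with t
        exact lintegral_const_mul _ (by fun_prop)
      · exact measurable_G.comp_snd.mul (by fun_prop)
    _ ≤ (d : ℝ≥0∞) ^ k * ∫⁻ t in openCube d,
        G t * Q.indicator (fun _ => ENNReal.ofReal (s ^ d)⁻¹) t := by
      gcongr with t
      exact setLIntegral_enorm_comp_sub_le_indicator measurable_φ hφ1 hs
        (fun w hw' => (subset_tsupport _).trans ((hsupp w hw').trans Set.inter_subset_left)) t
    _ = _ := by
      rw [derivMeasure, withDensity_apply _ hQ, ← lintegral_indicator hQ,
        ← lintegral_const_mul' _ _ ENNReal.ofReal_ne_top]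
      refine congrArg _ (lintegral_congr fun t => ?_)
      by_cases ht : t ∈ Q <;> simp [ht, G, mul_comm]

theorem closedBall_subset_cube_inter_openCube {a : Fin d → ℝ} {h ε : ℝ} (ha : IsSubcube a h)
    (hε : 0 < ε) (hεh : 4 * ε ≤ h) {w : Fin d → ℝ} (hw : w ∈ Set.Icc (0 : Fin d → ℝ) 1) :
    Metric.closedBall ((a + fun _ => 2 * ε) + (h - 4 * ε) • w) ε ⊆ cube a h ∩ openCube d := by
  intro t ht
  have bounds (i : Fin d) : a i + ε ≤ t i ∧ t i ≤ a i + h - ε := by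
    have dist_le := (dist_pi_le_iff hε.le).1 (Metric.mem_closedBall.1 ht) i
    rw [Real.dist_eq, abs_le] at dist_le
    simp only [Pi.add_apply, Pi.smul_apply, smul_eq_mul] at dist_le
    have := mul_nonneg (sub_nonneg.2 hεh) (hw.1 i)
    have := mul_le_of_le_one_right (sub_nonneg.2 hεh) (hw.2 i)
    constructor <;> linarith
  refine ⟨fun i _ => ⟨?_, ?_⟩, fun i _ => ⟨?_, ?_⟩⟩ <;>
    linarith [bounds i, ha.nonneg i, ha.add_le_one i]

theorem tendsto_convolution_normed_comp (hf : Continuous f) {φ : ℕ → ContDiffBump (0 : Fin d → ℝ)}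
    (hφ : Tendsto (fun n => (φ n).rOut) atTop (𝓝 0)) {y : ℕ → Fin d → ℝ} {x : Fin d → ℝ}
    (hy : Tendsto y atTop (𝓝 x)) :
    Tendsto (fun n => (f ⋆[lsmul ℝ ℝ, volume] (φ n).normed volume) (y n)) atTop (𝓝 (f x)) := by
  have tends := ContDiffBump.convolution_tendsto_right (μ := volume) (g := fun _ => f) hφ
    (Eventually.of_forall fun _ => hf.aestronglyMeasurable)
    ((hf.tendsto x).comp tendsto_snd) hy
  simp only [convolution_lsmul_swap, smul_eq_mul]
  simpa only [convolution_def, lsmul_apply, smul_eq_mul, mul_comm] using tends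

theorem lintegral_iteratedFDeriv_convolution_normed_sq_le (hw : HasWeakDeriv k f g)
    (hf : Continuous f) {a : Fin d → ℝ} {h : ℝ} (ha : IsSubcube a h)
    (φ : ContDiffBump (0 : Fin d → ℝ)) (hφ : 4 * φ.rOut < h) :
    ∫⁻ w in Set.Icc (0 : Fin d → ℝ) 1, ‖iteratedFDeriv ℝ k
        (f ⋆[lsmul ℝ ℝ, volume] φ.normed volume)
        ((a + fun _ => 2 * φ.rOut) + (h - 4 * φ.rOut) • w)‖ₑ ^ 2
      ≤ (d : ℝ≥0∞) ^ k * (ENNReal.ofReal ((h - 4 * φ.rOut) ^ d)⁻¹ * derivMeasure g (cube a h)) := by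
  refine lintegral_iteratedFDeriv_convolution_sq_le hw hf.locallyIntegrable φ.contDiff_normed
    φ.hasCompactSupport_normed ?_ (sub_pos.2 hφ) (measurableSet_cube a h) fun w hw' => ?_
  · rw [← ofReal_integral_norm_eq_lintegral_enorm φ.integrable_normed]
    simp only [Real.norm_of_nonneg (φ.nonneg_normed _), φ.integral_normed, ENNReal.ofReal_one,
      le_rfl]
  · refine (closure_minimal (fun t ht => ?_) Metric.isClosed_closedBall).trans
      (closedBall_subset_cube_inter_openCube ha φ.rOut_pos hφ.le hw')
    have mem_support : _ ∈ Function.support (φ.normed volume) := ht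
    rw [φ.support_normed_eq, mem_ball_zero_iff, ← dist_eq_norm, dist_comm] at mem_support
    exact mem_support.le

theorem rpow_sub_half_sq {s : ℝ} (hs : 0 < s) (k d : ℕ) :
    (s ^ ((k : ℝ) - d / 2)) ^ 2 = (s ^ k) ^ 2 * (s ^ d)⁻¹ := by
  rw [← Real.rpow_natCast, ← Real.rpow_mul hs.le, ← Real.rpow_natCast s k,
    ← Real.rpow_natCast _ 2, ← Real.rpow_mul hs.le, ← Real.rpow_natCast s d, ← Real.rpow_neg hs.le,
    ← Real.rpow_add hs]
  congr 1
  push_cast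
  ring

/-- The mollification of `f` by `φ` on `cube a h`, in the coordinates of the unit cube. The cube is
shrunk so that only values of `f` inside it enter. -/
noncomputable def mollifyOnCube (f : (Fin d → ℝ) → ℝ) (φ : ContDiffBump (0 : Fin d → ℝ))
    (a : Fin d → ℝ) (h : ℝ) (z : Fin d → ℝ) : ℝ :=
  (f ⋆[lsmul ℝ ℝ, volume] φ.normed volume) ((a + fun _ => 2 * φ.rOut) + (h - 4 * φ.rOut) • z)

theorem tendsto_mollifyOnCube (hf : Continuous f) {φ : ℕ → ContDiffBump (0 : Fin d → ℝ)}
    (hφ : Tendsto (fun n => (φ n).rOut) atTop (𝓝 0)) (a : Fin d → ℝ) (h : ℝ) (z : Fin d → ℝ) :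
    Tendsto (fun n => mollifyOnCube f (φ n) a h z) atTop (𝓝 (f (a + h • z))) := by
  refine tendsto_convolution_normed_comp hf hφ ?_
  have affine : Continuous fun t : ℝ => (a + fun _ => 2 * t) + (h - 4 * t) • z := by fun_prop
  have limit : (a + fun _ => 2 * (0 : ℝ)) + (h - 4 * 0) • z = a + h • z := by
    ext i
    simp
  exact limit ▸ (affine.tendsto 0).comp hφ

theorem enorm_mollifyOnCube_sub_tensorInterpolant_le (hk : (d : ℝ) / 2 < k)
    (hw : HasWeakDeriv k f g) (hf : Continuous f) {a : Fin d → ℝ} {h : ℝ} (ha : IsSubcube a h)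
    (φ : ContDiffBump (0 : Fin d → ℝ)) (hφ : 4 * φ.rOut < h) {x : Fin d → ℝ}
    (hx : x ∈ Set.Icc (0 : Fin d → ℝ) 1) :
    ‖mollifyOnCube f φ a h x - tensorInterpolant k (mollifyOnCube f φ a h) x‖ₑ
      ≤ (1 + ∑ i : Fin d → Fin k, ‖tensorLagrange i x‖ₑ) *
        (kernelConst k d * ((d : ℝ≥0∞) ^ k * (ENNReal.ofReal (h ^ ((k : ℝ) - d / 2)) ^ 2
          * derivMeasure g (cube a h))) ^ (1 / 2 : ℝ)) := by
  set s := h - 4 * φ.rOut with s_def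
  have s_pos : 0 < s := sub_pos.2 hφ
  have s_le : s ≤ h := by linarith [φ.rOut_pos]
  have smooth_u : ContDiff ℝ k (f ⋆[lsmul ℝ ℝ, volume] φ.normed volume) :=
    (φ.hasCompactSupport_normed.contDiff_convolution_right (n := k) _ hf.locallyIntegrable
      φ.contDiff_normed)
  refine (enorm_sub_tensorInterpolant_le ?_ ?_ hx).trans ?_
  · exact_mod_cast (by positivity : (0 : ℝ) ≤ d / 2).trans_lt hk
  · unfold mollifyOnCube
    fun_prop
  gcongr
  calc ∫⁻ w in Set.Icc (0 : Fin d → ℝ) 1, ‖iteratedFDeriv ℝ k (mollifyOnCube f φ a h) w‖ₑ ^ 2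
      = ENNReal.ofReal ((s ^ k) ^ 2) * ∫⁻ w in Set.Icc (0 : Fin d → ℝ) 1, ‖iteratedFDeriv ℝ k
        (f ⋆[lsmul ℝ ℝ, volume] φ.normed volume)
        ((a + fun _ => 2 * φ.rOut) + s • w)‖ₑ ^ 2 := by
        rw [← lintegral_const_mul' _ _ ENNReal.ofReal_ne_top]
        unfold mollifyOnCube
        simp only [← s_def, iteratedFDeriv_comp_add_smul smooth_u, enorm_smul, mul_pow,
          Real.enorm_of_nonneg (pow_nonneg s_pos.le k), ENNReal.ofReal_pow (pow_nonneg s_pos.le k)]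
    _ ≤ ENNReal.ofReal ((s ^ k) ^ 2) *
        ((d : ℝ≥0∞) ^ k * (ENNReal.ofReal (s ^ d)⁻¹ * derivMeasure g (cube a h))) := by
        gcongr
        exact lintegral_iteratedFDeriv_convolution_normed_sq_le hw hf ha φ hφ
    _ = (d : ℝ≥0∞) ^ k * (ENNReal.ofReal (s ^ ((k : ℝ) - d / 2)) ^ 2
          * derivMeasure g (cube a h)) := by
        rw [← ENNReal.ofReal_pow (by positivity), rpow_sub_half_sq s_pos,
          ENNReal.ofReal_mul (by positivity)]
        ring
    _ ≤ _ := by gcongr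

theorem exists_enorm_sub_tensorInterpolant_le (hk : (d : ℝ) / 2 < k) :
    ∃ C : ℝ≥0∞, C ≠ ⊤ ∧ ∀ (f : (Fin d → ℝ) → ℝ) (g : (Fin k → Fin d) → (Fin d → ℝ) → ℝ)
      (a : Fin d → ℝ) (h : ℝ), Continuous f → HasWeakDeriv k f g → IsSubcube a h →
      ∀ x ∈ Set.Icc (0 : Fin d → ℝ) 1,
      ‖f (a + h • x) - tensorInterpolant k (fun z => f (a + h • z)) x‖ₑ
        ≤ C * (ENNReal.ofReal (h ^ ((k : ℝ) - d / 2)) *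
          derivMeasure g (cube a h) ^ (1 / 2 : ℝ)) := by
  obtain ⟨K, -, hK⟩ := exists_sum_abs_tensorLagrange_le d k
  refine ⟨(1 + ENNReal.ofReal K) * (kernelConst k d * ((d : ℝ≥0∞) ^ k) ^ (1 / 2 : ℝ)), ?_, ?_⟩
  · have := (kernelConst_lt_top hk).ne
    finiteness
  intro f g a h hf hw ha x hx
  obtain ⟨ε, -, hε, ε_tendsto⟩ := exists_seq_strictAnti_tendsto' (div_pos ha.pos four_pos)
  let φ (n : ℕ) : ContDiffBump (0 : Fin d → ℝ) :=
    ⟨ε n / 2, ε n, half_pos (hε n).1, half_lt_self (hε n).1⟩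
  have v_tendsto (z : Fin d → ℝ) := tendsto_mollifyOnCube (φ := φ) hf ε_tendsto a h z
  have error_tendsto := ((v_tendsto x).sub (tendsto_finsetSum Finset.univ
    fun (i : Fin d → Fin k) _ => (v_tendsto (nodePoint i)).const_mul (tensorLagrange i x))).enorm
  refine le_of_tendsto' error_tendsto fun n => ?_
  refine (enorm_mollifyOnCube_sub_tensorInterpolant_le hk hw hf ha (φ n) ?_ hx).trans ?_
  · linarith [(hε n).2]
  have sum_le : ∑ i : Fin d → Fin k, ‖tensorLagrange i x‖ₑ ≤ ENNReal.ofReal K := by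
    simp only [Real.enorm_eq_ofReal_abs]
    rw [← ENNReal.ofReal_sum_of_nonneg fun _ _ => abs_nonneg _]
    exact ENNReal.ofReal_le_ofReal (hK x hx)
  have sqrt_scaling (A R V : ℝ≥0∞) :
      (A * (R ^ 2 * V)) ^ (1 / 2 : ℝ) = A ^ (1 / 2 : ℝ) * (R * V ^ (1 / 2 : ℝ)) := by
    rw [ENNReal.mul_rpow_of_nonneg _ _ (by norm_num), ENNReal.mul_rpow_of_nonneg _ _ (by norm_num),
      ← ENNReal.rpow_natCast R, ← ENNReal.rpow_mul]
    norm_num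
  rw [sqrt_scaling, ← mul_assoc (kernelConst k d), ← mul_assoc]
  gcongr

end Mollification

section Sampling

variable {d k N : ℕ} {a b : Fin d → ℝ} {h s : ℝ}

theorem exists_abs_sub_tensorInterpolant_le (hk : (d : ℝ) / 2 < k) :
    ∃ C : ℝ, 0 ≤ C ∧ ∀ (f : (Fin d → ℝ) → ℝ) (g : (Fin k → Fin d) → (Fin d → ℝ) → ℝ)
      (a : Fin d → ℝ) (h : ℝ), Continuous f → HasWeakDeriv k f g →
      IsFiniteMeasure (derivMeasure g) → IsSubcube a h → ∀ x ∈ Set.Icc (0 : Fin d → ℝ) 1,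
      |f (a + h • x) - tensorInterpolant k (fun z => f (a + h • z)) x|
        ≤ C * (h ^ ((k : ℝ) - d / 2) * √((derivMeasure g).real (cube a h))) := by
  obtain ⟨C, hC, bound⟩ := exists_enorm_sub_tensorInterpolant_le hk
  refine ⟨C.toReal, ENNReal.toReal_nonneg, fun f g a h hf hw hfin ha x hx => ?_⟩
  have hh := ha.pos.le
  have key := bound f g a h hf hw ha x hx
  rwa [Real.enorm_eq_ofReal_abs, ← ENNReal.ofReal_toReal hC, ← ofReal_measureReal,
    ENNReal.ofReal_rpow_of_nonneg measureReal_nonneg (by norm_num), ← Real.sqrt_eq_rpow,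
    ← ENNReal.ofReal_mul (by positivity), ← ENNReal.ofReal_mul ENNReal.toReal_nonneg,
    ENNReal.ofReal_le_ofReal_iff (by positivity)] at key

theorem IsSubcube.cube_subset_Icc (ha : IsSubcube a h) : cube a h ⊆ Set.Icc 0 1 := fun _ hx =>
  ⟨fun i => (ha.nonneg i).trans (hx i trivial).1,
    fun i => (hx i trivial).2.le.trans (ha.add_le_one i)⟩

theorem isSubcube_of_cube_subset_Icc (hh : 0 < h) (hs : cube a h ⊆ Set.Icc 0 1) :
    IsSubcube a h := by
  have corner : a ∈ cube a h := fun j _ => ⟨le_rfl, lt_add_of_pos_right _ hh⟩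
  refine ⟨hh, (hs corner).1, fun i => le_of_forall_lt_imp_le_of_dense fun v hv => ?_⟩
  rcases le_total v (a i) with hva | hva
  · exact hva.trans ((hs corner).2 i)
  have hmem : Function.update a i v ∈ cube a h := by
    intro j hj
    rcases eq_or_ne j i with rfl | hji
    · simpa only [Function.update_self] using ⟨hva, hv⟩
    · simpa only [Function.update_of_ne hji] using corner j hj
  simpa only [Function.update_self, Pi.one_apply] using (hs hmem).2 i

theorem volume_real_cube (a : Fin d → ℝ) (hh : 0 ≤ h) : volume.real (cube a h) = h ^ d := by
  rw [measureReal_def, cube, Real.volume_pi_Ico_toReal fun i => le_add_of_nonneg_right hh]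
  simp

theorem IsSubcube.add_smul (ha : IsSubcube a h) (hb : IsSubcube b s) :
    IsSubcube (a + h • b) (h * s) where
  pos := mul_pos ha.pos hb.pos
  nonneg i := add_nonneg (ha.nonneg i) (mul_nonneg ha.pos.le (hb.nonneg i))
  add_le_one i := by
    have := mul_le_of_le_one_right ha.pos.le (hb.add_le_one i)
    have := ha.add_le_one i
    simp only [Pi.add_apply, Pi.smul_apply, smul_eq_mul]
    linarith

theorem cube_add_smul (hh : 0 < h) (a b : Fin d → ℝ) (s : ℝ) :
    cube (a + h • b) (h * s) = (fun z => a + h • z) '' cube b s := by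
  ext x
  constructor
  · intro hx
    refine ⟨h⁻¹ • (x - a), fun i _ => ?_, by simp [smul_inv_smul₀ hh.ne']⟩
    have := hx i trivial
    simp only [Pi.add_apply, Pi.smul_apply, Pi.sub_apply, smul_eq_mul, Set.mem_Ico,
      inv_mul_eq_div] at this ⊢
    rw [le_div_iff₀ hh, div_lt_iff₀ hh]
    constructor <;> linarith
  · rintro ⟨z, hz, rfl⟩ i -
    have lower := mul_le_mul_of_nonneg_left (hz i trivial).1 hh.le
    have upper := mul_lt_mul_of_pos_left (hz i trivial).2 hh
    simp only [Pi.add_apply, Pi.smul_apply, smul_eq_mul, Set.mem_Ico]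
    constructor <;> linarith

theorem isSubcube_nodePoint (hs : 0 < s) (hsk : s ≤ 1 / k) (i : Fin d → Fin k) :
    IsSubcube (nodePoint i) s :=
  ⟨hs, nodePoint_nonneg i, fun m => by linarith [nodePoint_add_le_one i m]⟩

theorem half_le_card_filter_div_mem_Ico {a h : ℝ} (ha : 0 ≤ a) (hah : a + h ≤ 1)
    (hN : 1 ≤ N * h) :
    N * h / 2 ≤ ((Finset.univ.filter fun t : Fin N =>
      ((t : ℕ) : ℝ) / N ∈ Set.Ico a (a + h)).card : ℝ) := by
  have N_pos : (0 : ℝ) < N := by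
    rcases N.eq_zero_or_pos with rfl | hpos
    · norm_num at hN
    · exact_mod_cast hpos
  set p := ⌈N * a⌉₊
  set q := ⌈N * (a + h)⌉₊
  have hq : q ≤ N := Nat.ceil_le.2 (mul_le_of_le_one_right N_pos.le hah)
  have card_le : q - p ≤ (Finset.univ.filter fun t : Fin N =>
      ((t : ℕ) : ℝ) / N ∈ Set.Ico a (a + h)).card := by
    rw [← Nat.card_Ico, ← Finset.card_attachFin (Finset.Ico p q)
      fun m hm => (Finset.mem_Ico.1 hm).2.trans_le hq]
    refine Finset.card_le_card fun t ht => ?_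
    rw [Finset.mem_attachFin, Finset.mem_Ico] at ht
    refine Finset.mem_filter.2 ⟨Finset.mem_univ _, ?_, ?_⟩
    · rw [le_div_iff₀ N_pos, mul_comm]
      exact Nat.ceil_le.1 ht.1
    · rw [div_lt_iff₀ N_pos, mul_comm (a + h)]
      exact Nat.lt_ceil.1 ht.2
  have p_lt : (p : ℝ) < N * a + 1 := Nat.ceil_lt_add_one (mul_nonneg N_pos.le ha)
  have le_q : N * (a + h) ≤ (q : ℝ) := Nat.le_ceil _
  have p_lt_q : p < q := by
    have : (p : ℝ) < q := by linarith
    exact_mod_cast this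
  refine le_trans ?_ (Nat.cast_le.2 card_le)
  rw [Nat.cast_sub p_lt_q.le]
  have one_le : (p : ℝ) + 1 ≤ q := by exact_mod_cast p_lt_q
  rcases le_total (N * h) 2 <;> linarith

theorem IsSubcube.pow_le_card_gridIn (ha : IsSubcube a h) (hN : 1 ≤ N * h) :
    (N * h / 2) ^ d ≤ ((gridIn N (cube a h)).card : ℝ) := by
  have gridIn_eq : gridIn N (cube a h) = Fintype.piFinset fun i =>
      Finset.univ.filter fun t : Fin N => ((t : ℕ) : ℝ) / N ∈ Set.Ico (a i) (a i + h) := by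
    ext τ
    simp [gridIn, cube, gridPoint, Fintype.mem_piFinset, Set.mem_pi]
  rw [gridIn_eq, Fintype.card_piFinset, Nat.cast_prod, ← Fin.prod_const]
  exact Finset.prod_le_prod (fun _ _ => by linarith)
    fun i _ => half_le_card_filter_div_mem_Ico (ha.nonneg i) (ha.add_le_one i) hN

theorem gridPoint_mem_of_mem_gridIn {B : Set (Fin d → ℝ)} {τ : Fin d → Fin N}
    (hτ : τ ∈ gridIn N B) : gridPoint N τ ∈ B := by
  classical
  simpa [gridIn] using hτ

theorem mrNorm_nonneg (𝓑 : Set (Set (Fin d → ℝ))) (y : (Fin d → Fin N) → ℝ) : 0 ≤ mrNorm 𝓑 y :=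
  Real.iSup_nonneg fun _ => div_nonneg (abs_nonneg _) (Real.sqrt_nonneg _)

theorem abs_le_mrNorm_div_add {𝓑 : Set (Set (Fin d → ℝ))} {y : (Fin d → Fin N) → ℝ}
    {B : Set (Fin d → ℝ)} (hB : B ∈ 𝓑) (hcard : 0 < (gridIn N B).card) {t r : ℝ}
    (hr : ∀ τ ∈ gridIn N B, |t - y τ| ≤ r) :
    |t| ≤ mrNorm 𝓑 y / √(gridIn N B).card + r := by
  set n : ℝ := ((gridIn N B).card : ℝ)
  have n_pos : 0 < n := Nat.cast_pos.2 hcard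
  have sum_le : |∑ τ ∈ gridIn N B, y τ| ≤ mrNorm 𝓑 y * √n :=
    (div_le_iff₀ (Real.sqrt_pos.2 n_pos)).1 (le_ciSup (bddAbove_localSum 𝓑 y) ⟨B, hB⟩)
  have sum_sub_le : |∑ τ ∈ gridIn N B, (t - y τ)| ≤ n * r :=
    (Finset.abs_sum_le_sum_abs _ _).trans
      ((Finset.sum_le_card_nsmul _ _ _ hr).trans_eq (nsmul_eq_mul _ _))
  refine le_of_mul_le_mul_left ?_ n_pos
  calc n * |t| = |∑ τ ∈ gridIn N B, y τ + ∑ τ ∈ gridIn N B, (t - y τ)| := by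
        rw [← Finset.sum_add_distrib]
        simp [n, abs_mul]
    _ ≤ mrNorm 𝓑 y * √n + n * r := (abs_add_le _ _).trans (add_le_add sum_le sum_sub_le)
    _ = n * (mrNorm 𝓑 y / √n + r) := by
        rw [mul_add, mul_div_left_comm, Real.div_sqrt]

theorem IsNormalSystem.exists_subset_cube (hd : 0 < d) {c : ℝ} {𝓑 : Set (Set (Fin d → ℝ))}
    (h𝓑 : IsNormalSystem c 𝓑) (ha : IsSubcube a h) (hN : c ≤ N * h) :
    ∃ B ∈ 𝓑, B ⊆ cube a h ∧ (N * h / (2 * c)) ^ d ≤ ((gridIn N B).card : ℝ) := by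
  have hc := h𝓑.one_lt
  have c_pos : 0 < c := one_pos.trans hc
  have hh := ha.pos
  have h_le_one : h ≤ 1 := by linarith [ha.nonneg ⟨0, hd⟩, ha.add_le_one ⟨0, hd⟩]
  obtain ⟨B, hB, hsub, hvol⟩ := h𝓑.exists_subset (cube a h)
    ⟨a, h, hh, h_le_one, rfl, ha.cube_subset_Icc⟩
  obtain ⟨b, s, hs, -, rfl, hBs⟩ := h𝓑.isCube B hB
  change cube b s ∈ 𝓑 at hB
  change volume.real _ / c ≤ volume.real (cube b s) at hvol
  rw [volume_real_cube _ hh.le, volume_real_cube _ hs.le] at hvol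
  have side_le : h / c ≤ s := by
    refine le_of_pow_le_pow_left₀ hd.ne' hs.le (le_trans ?_ hvol)
    rw [div_pow]
    gcongr
    exact le_self_pow₀ hc.le hd.ne'
  have one_le : 1 ≤ N * (h / c) := by rwa [← mul_div_assoc, one_le_div c_pos]
  have N_side_le : N * (h / c) ≤ N * s := by gcongr
  refine ⟨_, hB, hsub, le_trans ?_ ((isSubcube_of_cube_subset_Icc hs hBs).pow_le_card_gridIn
    (one_le.trans N_side_le))⟩
  rw [mul_comm 2 c, ← div_div, mul_div_assoc]
  gcongr (?_ / 2) ^ d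

theorem IsNormalSystem.abs_le_mrNorm_div_add (hd : 0 < d) {c : ℝ} {𝓑 : Set (Set (Fin d → ℝ))}
    (h𝓑 : IsNormalSystem c 𝓑) (ha : IsSubcube a h) (hN : c ≤ N * h) {y : (Fin d → Fin N) → ℝ}
    {t r : ℝ} (hr : ∀ τ, gridPoint N τ ∈ cube a h → |t - y τ| ≤ r) :
    |t| ≤ mrNorm 𝓑 y / √((N * h / (2 * c)) ^ d) + r := by
  have c_pos : 0 < c := one_pos.trans h𝓑.one_lt
  obtain ⟨B, hB, hsub, hcard⟩ := h𝓑.exists_subset_cube hd ha hN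
  have pow_pos : 0 < (N * h / (2 * c)) ^ d :=
    pow_pos (div_pos (c_pos.trans_le hN) (by positivity)) d
  refine (MultiresolutionNorm.abs_le_mrNorm_div_add hB (Nat.cast_pos.1 (pow_pos.trans_le hcard))
    fun τ hτ => hr τ (hsub (gridPoint_mem_of_mem_gridIn hτ))).trans ?_
  have := mrNorm_nonneg 𝓑 y
  gcongr

theorem exists_forall_abs_le_of_interpolation_error (d : ℕ) (hk : 0 < k) :
    ∃ K δ : ℝ, 0 ≤ K ∧ 0 < δ ∧ (∀ i : Fin d → Fin k, IsSubcube (nodePoint i) δ) ∧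
      ∀ (u : (Fin d → ℝ) → ℝ) (E t : ℝ), 0 ≤ t →
      (∀ x ∈ Set.Icc (0 : Fin d → ℝ) 1, |u x - tensorInterpolant k u x| ≤ E) →
      (∀ (i : Fin d → Fin k) (r : ℝ), (∀ z ∈ cube (nodePoint i) δ, |u (nodePoint i) - u z| ≤ r) →
        |u (nodePoint i)| ≤ t + r) →
      ∀ x ∈ Set.Icc (0 : Fin d → ℝ) 1, |u x| ≤ K * (t + E) := by
  obtain ⟨K, K_nonneg, hK⟩ := exists_sum_abs_tensorLagrange_le d k
  obtain ⟨η, η_pos, hη⟩ := exists_sum_abs_tensorLagrange_sub_le d k one_half_pos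
  have δ_pos : 0 < min η (1 / k) := lt_min η_pos (by positivity)
  have node_subcube (i : Fin d → Fin k) := isSubcube_nodePoint δ_pos (min_le_right _ _) i
  refine ⟨1 + 2 * K, _, by positivity, δ_pos, node_subcube,
    fun u E t ht error_le average_le x hx => ?_⟩
  have : Nonempty (Fin k) := ⟨⟨0, hk⟩⟩
  obtain ⟨i, hi⟩ := Finite.exists_max fun i : Fin d → Fin k => |u (nodePoint i)|
  have near_node (z) (hz : z ∈ cube (nodePoint i) (min η (1 / k))) :
      |u (nodePoint i) - u z| ≤ E + 1 / 2 * |u (nodePoint i)| := by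
    have z_mem := (node_subcube i).cube_subset_Icc hz
    have dist_le : dist (nodePoint i) z ≤ η := by
      refine (dist_pi_le_iff η_pos.le).2 fun m => ?_
      rw [Real.dist_eq, abs_le]
      constructor <;> linarith [(hz m trivial).1, (hz m trivial).2, min_le_left η (1 / k)]
    have interpolant_sub_le := (abs_tensorInterpolant_sub_le hi (nodePoint i) z).trans
      (mul_le_mul_of_nonneg_right (hη _ (nodePoint_mem_Icc i) _ z_mem dist_le) (abs_nonneg _))
    rw [tensorInterpolant_nodePoint, abs_sub_comm] at interpolant_sub_le
    rw [abs_sub_comm]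
    exact (abs_sub_le _ _ _).trans (add_le_add (error_le z z_mem) interpolant_sub_le)
  have max_le := average_le i _ near_node
  have interpolant_le := (abs_tensorInterpolant_le hi x).trans
    (mul_le_mul_of_nonneg_right (hK x hx) (abs_nonneg _))
  have abs_le := abs_sub_abs_le_abs_sub (u x) (tensorInterpolant k u x)
  have K_mul_max_le : K * |u (nodePoint i)| ≤ K * (2 * (t + E)) := by gcongr; linarith
  linarith [error_le x hx]

/-- The supremum bound on the closed cubes of side `h ≥ h₀` by an averaged sampling term `σ` and
the mass of `ν`, which stands for `|D^k f|²`. -/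
def HasLocalBound (k : ℕ) (ν : Measure (Fin d → ℝ)) (A σ h₀ : ℝ) (f : (Fin d → ℝ) → ℝ) : Prop :=
  ∀ (a : Fin d → ℝ) (h : ℝ), IsSubcube a h → h₀ ≤ h → ∀ x ∈ Set.Icc (0 : Fin d → ℝ) 1,
    |f (a + h • x)| ≤
      A * (σ * h ^ (-((d : ℝ) / 2)) + h ^ ((k : ℝ) - d / 2) * √(ν.real (cube a h)))

theorem div_sqrt_pow_eq_mul_rpow (hh : 0 < h) (T ρ : ℝ) (hρ : 0 < ρ) (N d : ℕ) :
    T / √((N * (h * ρ)) ^ d) = (√(ρ ^ d))⁻¹ * (T / √(N ^ d) * h ^ (-((d : ℝ) / 2))) := by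
  have sqrt_pow_h : √(h ^ d) = h ^ ((d : ℝ) / 2) := by
    rw [Real.sqrt_eq_rpow, ← Real.rpow_natCast, ← Real.rpow_mul hh.le]
    ring_nf
  rw [mul_pow, mul_pow, Real.sqrt_mul (by positivity), Real.sqrt_mul (by positivity), sqrt_pow_h,
    Real.rpow_neg hh.le]
  field_simp

theorem exists_hasLocalBound (hd : 0 < d) (hk : (d : ℝ) / 2 < k) {c : ℝ} (hc : 1 < c) :
    ∃ A κ : ℝ, 0 < A ∧ 0 < κ ∧ ∀ 𝓑 : Set (Set (Fin d → ℝ)), IsNormalSystem c 𝓑 →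
      ∀ (f : (Fin d → ℝ) → ℝ) (g : (Fin k → Fin d) → (Fin d → ℝ) → ℝ),
      Continuous f → HasWeakDeriv k f g → IsFiniteMeasure (derivMeasure g) → ∀ N : ℕ, 0 < N →
      HasLocalBound k (derivMeasure g) A (mrNorm 𝓑 (sample N f) / √(N ^ d)) (κ / N) f := by
  have k_pos : 0 < k := by exact_mod_cast (by positivity : (0 : ℝ) ≤ d / 2).trans_lt hk
  have : 0 < c := one_pos.trans hc
  obtain ⟨C, C_nonneg, interpolation_error⟩ := exists_abs_sub_tensorInterpolant_le hk
  obtain ⟨K, δ, K_nonneg, δ_pos, node_subcube, abs_le⟩ :=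
    exists_forall_abs_le_of_interpolation_error d k_pos
  set L := (√((δ / (2 * c)) ^ d))⁻¹
  refine ⟨K * (L + C) + 1, c / δ, by positivity, by positivity,
    fun 𝓑 h𝓑 f g hf hw hfin N hN a h ha hh x hx => ?_⟩
  have h_pos := ha.pos
  have mrNorm_nonneg := mrNorm_nonneg 𝓑 (sample N f)
  set σ := mrNorm 𝓑 (sample N f) / √(N ^ d) * h ^ (-((d : ℝ) / 2)) with σ_def
  set E := h ^ ((k : ℝ) - d / 2) * √((derivMeasure g).real (cube a h))
  have σ_nonneg : 0 ≤ σ := by positivity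
  have E_nonneg : 0 ≤ E := by positivity
  have average_le (i : Fin d → Fin k) (r : ℝ) (hr : ∀ z ∈ cube (nodePoint i) δ,
      |f (a + h • nodePoint i) - f (a + h • z)| ≤ r) :
      |f (a + h • nodePoint i)| ≤ L * σ + r := by
    have hN' : c ≤ N * (h * δ) := by
      rw [div_le_iff₀ (by positivity), div_le_iff₀ δ_pos] at hh
      linarith
    have key := h𝓑.abs_le_mrNorm_div_add hd (ha.add_smul (node_subcube i)) hN'
      (y := sample N f) (t := f (a + h • nodePoint i)) (r := r) fun τ hτ => by
        rw [cube_add_smul h_pos] at hτ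
        obtain ⟨z, hz, hzτ⟩ := hτ
        rw [sample, ← hzτ]
        exact hr z hz
    rwa [mul_div_assoc, mul_div_assoc, div_sqrt_pow_eq_mul_rpow h_pos _ _ (by positivity)] at key
  refine (abs_le (fun z => f (a + h • z)) (C * E) (L * σ) (by positivity)
    (interpolation_error f g a h hf hw hfin ha) average_le x hx).trans ?_
  have : 0 ≤ K * (L * E + C * σ) + (σ + E) := by positivity
  linarith

end Sampling

section Stopping

variable {d k s : ℕ} {a : Fin d → ℝ} {h : ℝ}

theorem floor_eq_of_mem_cube_nodePoint {i : Fin d → Fin k} {x : Fin d → ℝ}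
    (hx : x ∈ cube (nodePoint i) (1 / k)) (m : Fin d) : ⌊k * x m⌋₊ = i m := by
  have k_pos : (0 : ℝ) < k := Nat.cast_pos.2 (i m).pos
  obtain ⟨lower, upper⟩ := hx m trivial
  rw [nodePoint, node, div_le_iff₀' k_pos] at lower
  rw [nodePoint, node, ← add_div, lt_div_iff₀' k_pos] at upper
  exact (Nat.floor_eq_iff ((Nat.cast_nonneg _).trans lower)).2 ⟨lower, upper⟩

theorem iUnion_cube_nodePoint (hk : 0 < k) :
    ⋃ i : Fin d → Fin k, cube (nodePoint i) (1 / k) = cube 0 1 := by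
  have k_pos : (0 : ℝ) < k := Nat.cast_pos.2 hk
  refine subset_antisymm (Set.iUnion_subset fun i x hx m _ => ?_) fun x hx => Set.mem_iUnion.2 ?_
  · refine ⟨(nodePoint_nonneg i m).trans (hx m trivial).1, (hx m trivial).2.trans_le ?_⟩
    simpa using nodePoint_add_le_one i m
  · have x_nonneg (m : Fin d) : 0 ≤ x m := (hx m trivial).1
    have x_lt (m : Fin d) : x m < 1 := by simpa using (hx m trivial).2
    have floor_lt (m : Fin d) : ⌊k * x m⌋₊ < k :=
      (Nat.floor_lt (mul_nonneg k_pos.le (x_nonneg m))).2 (mul_lt_of_lt_one_right k_pos (x_lt m))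
    refine ⟨fun m => ⟨⌊k * x m⌋₊, floor_lt m⟩, fun m _ => ?_⟩
    simp only [nodePoint, node, ← add_div, Set.mem_Ico, div_le_iff₀' k_pos, lt_div_iff₀' k_pos]
    exact ⟨Nat.floor_le (mul_nonneg k_pos.le (x_nonneg m)), Nat.lt_floor_add_one _⟩

theorem cube_eq_image_cube_zero_one (hh : 0 < h) (a : Fin d → ℝ) :
    cube a h = (fun z => a + h • z) '' cube 0 1 := by
  rw [← cube_add_smul hh, smul_zero, add_zero, mul_one]

theorem sum_measureReal_cube_nodePoint (μ : Measure (Fin d → ℝ)) [IsFiniteMeasure μ] (hk : 0 < k)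
    (hh : 0 < h) (a : Fin d → ℝ) :
    ∑ i : Fin d → Fin k, μ.real (cube (a + h • nodePoint i) (h * (1 / k))) = μ.real (cube a h) := by
  have disjoint : Pairwise fun i j : Fin d → Fin k => Disjoint
      (cube (a + h • nodePoint i) (h * (1 / k))) (cube (a + h • nodePoint j) (h * (1 / k))) := by
    intro i j hij
    have injective : Function.Injective fun z : Fin d → ℝ => a + h • z :=
      (add_right_injective a).comp (smul_right_injective _ hh.ne')
    rw [cube_add_smul hh, cube_add_smul hh, Set.disjoint_image_iff injective]
    refine Set.disjoint_left.2 fun x hi hj => hij (funext fun m => Fin.ext ?_)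
    rw [← floor_eq_of_mem_cube_nodePoint hi m, floor_eq_of_mem_cube_nodePoint hj m]
  have union : ⋃ i : Fin d → Fin k, cube (a + h • nodePoint i) (h * (1 / k)) = cube a h := by
    simp only [cube_add_smul hh, ← Set.image_iUnion, iUnion_cube_nodePoint hk,
      ← cube_eq_image_cube_zero_one hh]
  rw [← union, measureReal_iUnion_fintype disjoint fun _ => measurableSet_cube _ _]

theorem le_of_le_measureReal_mul_pow {ν : Measure (Fin d → ℝ)} [IsFiniteMeasure ν] {t h₀ : ℝ}
    (ht : 0 < t) (hh : 0 ≤ h) (hs : s ≠ 0) (hν : ν.real Set.univ * h₀ ^ s ≤ t)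
    {Q : Set (Fin d → ℝ)} (hQ : t ≤ ν.real Q * h ^ s) : h₀ ≤ h := by
  by_contra! hlt
  have ν_pos : 0 < ν.real Q :=
    pos_of_mul_pos_left (ht.trans_le hQ) (pow_nonneg hh s)
  have : ν.real Q * h ^ s < ν.real Set.univ * h₀ ^ s :=
    mul_lt_mul' (measureReal_mono (Set.subset_univ _)) (pow_lt_pow_left₀ hlt hh hs)
      (pow_nonneg hh s) (ν_pos.trans_le (measureReal_mono (Set.subset_univ _)))
  linarith

theorem sum_add_le_sum_of_small_or_large {ι : Type*} [Fintype ι] [Nonempty ι] {x y : ι → ℝ}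
    {b : ℝ} (hb : 0 ≤ b) (hy : ∀ i, 0 ≤ y i) (hsum : 2 * b ≤ ∑ i, y i)
    (hx : ∀ i, x i ≤ b / Fintype.card ι ∨ x i + 2 * b ≤ y i) :
    ∑ i, x i + b ≤ ∑ i, y i := by
  classical
  have sum_const : ∑ _i : ι, b / Fintype.card ι = b := by simp [mul_div_cancel₀]
  have share_nonneg : 0 ≤ b / Fintype.card ι := by positivity
  by_cases all_small : ∀ i, x i ≤ b / Fintype.card ι
  · have := Finset.sum_le_sum fun i (_ : i ∈ Finset.univ) => all_small i
    linarith
  · push Not at all_small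
    obtain ⟨j, hj⟩ := all_small
    have le_share (i : ι) : x i ≤ b / Fintype.card ι + y i - if i = j then 2 * b else 0 := by
      split_ifs with hij
      · subst hij
        linarith [(hx i).resolve_left hj.not_ge]
      · rcases hx i with hi | hi <;> linarith [hy i]
    have := Finset.sum_le_sum fun i (_ : i ∈ Finset.univ) => le_share i
    rw [Finset.sum_sub_distrib, Finset.sum_add_distrib, sum_const, Finset.sum_ite_eq'] at this
    simp only [Finset.mem_univ, if_true] at this
    linarith

/-- Halve cubes until `ν Q * h ^ s < t`. The extra term on the left strengthens the induction
hypothesis: a large child contributes it `2 ^ s` times over, which pays for its small siblings. -/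
theorem measureReal_add_le_of_stopping {μ ν : Measure (Fin d → ℝ)} [IsFiniteMeasure μ]
    [IsFiniteMeasure ν] {t h₀ K : ℝ} (hs : s ≠ 0) (ht : 0 < t) (hK : 0 ≤ K)
    (hν : ν.real Set.univ * h₀ ^ s ≤ t)
    (small : ∀ (a : Fin d → ℝ) (h : ℝ), IsSubcube a h → h₀ / 2 ≤ h →
      ν.real (cube a h) * h ^ s < t → μ.real (cube a h) ≤ K * (h ^ s)⁻¹)
    (m : ℕ) (ha : IsSubcube a h) (hm : h < 2 ^ m * h₀) (large : t ≤ ν.real (cube a h) * h ^ s) :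
    μ.real (cube a h) + 2 ^ d * 2 ^ s * K * (h ^ s)⁻¹
      ≤ 2 * (2 ^ d * 2 ^ s * K) * (ν.real (cube a h) / t) := by
  induction m generalizing a h with
  | zero =>
    have := le_of_le_measureReal_mul_pow ht ha.pos.le hs hν large
    linarith
  | succ m ih =>
    have h_pos := ha.pos
    have h₀_le := le_of_le_measureReal_mul_pow ht h_pos.le hs hν large
    set c := 2 ^ d * 2 ^ s * K with c_def
    set J := (h ^ s)⁻¹
    have inv_le : J ≤ ν.real (cube a h) / t := by
      rwa [le_div_iff₀ ht, inv_mul_le_iff₀ (pow_pos h_pos s), mul_comm]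
    let Q (i : Fin d → Fin 2) := cube (a + h • nodePoint i) (h * (1 / (2 : ℕ)))
    have sum_μ : ∑ i, μ.real (Q i) = μ.real (cube a h) :=
      sum_measureReal_cube_nodePoint μ two_pos h_pos a
    have sum_ν : ∑ i, 2 * c * (ν.real (Q i) / t) = 2 * c * (ν.real (cube a h) / t) := by
      rw [← Finset.mul_sum, ← Finset.sum_div, sum_measureReal_cube_nodePoint ν two_pos h_pos a]
    have child_inv : ((h * (1 / (2 : ℕ))) ^ s)⁻¹ = 2 ^ s * J := by
      rw [mul_pow, mul_inv, mul_comm]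
      simp [J]
    rw [← sum_μ, ← sum_ν]
    refine sum_add_le_sum_of_small_or_large (b := c * J) (by positivity) (fun i => by positivity)
      ?_ fun i => ?_
    · rw [sum_ν, ← mul_assoc]
      gcongr
    have child : IsSubcube (a + h • nodePoint i) (h * (1 / (2 : ℕ))) :=
      ha.add_smul (isSubcube_nodePoint (by norm_num) le_rfl i)
    rcases lt_or_ge (ν.real (Q i) * (h * (1 / (2 : ℕ))) ^ s) t with hi | hi
    · left
      refine (small _ _ child (by push_cast; linarith) hi).trans_eq ?_
      rw [child_inv, c_def, Fintype.card_fun, Fintype.card_fin, Fintype.card_fin]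
      push_cast
      field_simp
    · right
      have two_le : (2 : ℝ) ≤ 2 ^ s := le_self_pow₀ one_le_two hs
      have doubled : 2 * (c * J) ≤ c * (2 ^ s * J) := by
        rw [mul_left_comm]
        gcongr
      refine le_trans ?_ (ih child (by rw [pow_succ] at hm; push_cast; linarith) hi)
      rw [child_inv]
      gcongr

end Stopping

section LocalBound

variable {d k : ℕ} {A σ h₀ h : ℝ} {f : (Fin d → ℝ) → ℝ} {a x : Fin d → ℝ}

theorem isSubcube_zero_one : IsSubcube (0 : Fin d → ℝ) 1 :=
  ⟨one_pos, fun _ => le_rfl, fun _ => by simp⟩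

theorem rpow_sub_mul_sqrt_le (hh : 0 < h) (hσ : 0 ≤ σ) {v : ℝ} (hv : v * h ^ (2 * k) ≤ σ ^ 2) :
    h ^ ((k : ℝ) - d / 2) * √v ≤ σ * h ^ (-((d : ℝ) / 2)) := by
  have sqrt_mul_le : √v * h ^ k ≤ σ := by
    calc √v * h ^ k = √(v * h ^ (2 * k)) := by
          rw [Real.sqrt_mul' _ (by positivity), pow_mul', Real.sqrt_sq (by positivity)]
      _ ≤ σ := (Real.sqrt_le_sqrt hv).trans_eq (Real.sqrt_sq hσ)
  rw [sub_eq_add_neg, Real.rpow_add hh, Real.rpow_natCast, mul_right_comm, mul_comm (h ^ k)]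
  gcongr

theorem HasLocalBound.mono {ν : Measure (Fin d → ℝ)} (hf : HasLocalBound k ν A σ h₀ f)
    (hA : 0 ≤ A) {σ' h₁ : ℝ} (hσ : σ ≤ σ') (hh : h₀ ≤ h₁) : HasLocalBound k ν A σ' h₁ f := by
  intro a h ha hh₁ x hx
  have := ha.pos
  refine (hf a h ha (hh.trans hh₁) x hx).trans ?_
  gcongr

theorem HasLocalBound.abs_le {ν : Measure (Fin d → ℝ)} (hf : HasLocalBound k ν A σ h₀ f)
    (hA : 0 ≤ A) (hσ : 0 ≤ σ) (ha : IsSubcube a h) (hh : h₀ ≤ h)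
    (hν : ν.real (cube a h) * h ^ (2 * k) ≤ σ ^ 2) (hx : x ∈ Set.Icc 0 1) :
    |f (a + h • x)| ≤ 2 * A * σ * h ^ (-((d : ℝ) / 2)) := by
  have := mul_le_mul_of_nonneg_left (rpow_sub_mul_sqrt_le (d := d) ha.pos hσ hν) hA
  linarith [hf a h ha hh x hx]

theorem HasLocalBound.abs_le_of_le_one {ν : Measure (Fin d → ℝ)} [IsFiniteMeasure ν]
    (hf : HasLocalBound k ν A σ h₀ f) (hA : 0 ≤ A) (hσ : 0 ≤ σ) (h_pos : 0 < h) (hh : h₀ ≤ h)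
    (h_le : h ≤ 1) (hν : ν.real Set.univ * h ^ (2 * k) ≤ σ ^ 2) (hx : x ∈ Set.Icc 0 1) :
    |f x| ≤ 2 * A * σ * h ^ (-((d : ℝ) / 2)) := by
  have subcube : IsSubcube ((1 - h) • x) h := by
    refine ⟨h_pos, fun i => mul_nonneg (sub_nonneg.2 h_le) (hx.1 i), fun i => ?_⟩
    have := mul_le_of_le_one_right (sub_nonneg.2 h_le) (hx.2 i)
    simp only [Pi.smul_apply, smul_eq_mul] at this ⊢
    linarith
  have key := hf.abs_le hA hσ subcube hh ((mul_le_mul_of_nonneg_right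
    (measureReal_mono (Set.subset_univ _)) (by positivity)).trans hν) hx
  rwa [← add_smul, sub_add_cancel, one_smul] at key

theorem HasLocalBound.abs_le_div_rpow {ν : Measure (Fin d → ℝ)} [IsFiniteMeasure ν]
    (hf : HasLocalBound k ν A σ h₀ f) (hk : 0 < k) (hA : 0 ≤ A) (hσ : 0 < σ) {D : ℝ}
    (hh₀ : 0 ≤ h₀) (hD : ν.real Set.univ = D ^ 2) (hσD : σ ≤ D) (hDσ : D * h₀ ^ k ≤ σ)
    (hx : x ∈ Set.Icc 0 1) :
    |f x| ≤ 2 * A * σ * (D / σ) ^ ((d : ℝ) / (2 * k)) := by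
  have D_pos : 0 < D := hσ.trans_le hσD
  have ratio_pos : 0 < σ / D := by positivity
  have pow_eq : ((σ / D) ^ (k : ℝ)⁻¹) ^ k = σ / D := Real.rpow_inv_natCast_pow ratio_pos.le hk.ne'
  have key := hf.abs_le_of_le_one (h := (σ / D) ^ (k : ℝ)⁻¹) hA hσ.le (by positivity) ?_ ?_ ?_ hx
  · convert key using 2
    rw [← Real.rpow_mul ratio_pos.le, mul_neg, Real.rpow_neg_eq_inv_rpow, inv_div]
    ring_nf
  · rw [← pow_le_pow_iff_left₀ hh₀ (by positivity) hk.ne', pow_eq, le_div_iff₀' D_pos]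
    exact hDσ
  · exact Real.rpow_le_one ratio_pos.le ((div_le_one D_pos).2 hσD) (by positivity)
  · rw [hD, mul_comm 2 k, pow_mul, pow_eq, div_pow, mul_div_cancel₀]
    positivity

theorem setLIntegral_enorm_rpow_le {α : Type*} [MeasurableSpace α] {μ : Measure α} {u : α → ℝ}
    {s : Set α} {p B : ℝ} (hs : MeasurableSet s) (hp : 0 ≤ p) (hB : 0 ≤ B)
    (hu : ∀ x ∈ s, |u x| ≤ B) : ∫⁻ x in s, ‖u x‖ₑ ^ p ∂μ ≤ ENNReal.ofReal (B ^ p) * μ s := by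
  rw [← setLIntegral_const, ← ENNReal.ofReal_rpow_of_nonneg hB hp]
  refine setLIntegral_mono' hs fun x hx => ENNReal.rpow_le_rpow ?_ hp
  rw [Real.enorm_eq_ofReal_abs]
  exact ENNReal.ofReal_le_ofReal (hu x hx)

/-- The exponent `(4k + 2d) / d` at which the two branches of `vartheta` meet. -/
noncomputable def criticalExponent (k d : ℕ) : ℝ := (4 * k + 2 * d) / d

theorem criticalExponent_nonneg (k d : ℕ) : 0 ≤ criticalExponent k d := by
  unfold criticalExponent
  positivity

theorem mul_rpow_criticalExponent_mul_pow (hd : 0 < d) (hh : 0 < h) {B : ℝ} (hB : 0 ≤ B) :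
    (B * h ^ (-((d : ℝ) / 2))) ^ criticalExponent k d * h ^ d
      = B ^ criticalExponent k d * (h ^ (2 * k))⁻¹ := by
  rw [Real.mul_rpow hB (by positivity), mul_assoc, ← Real.rpow_natCast, ← Real.rpow_natCast,
    ← Real.rpow_neg hh.le, ← Real.rpow_mul hh.le, ← Real.rpow_add hh, criticalExponent]
  congr 2
  push_cast
  field_simp
  ring

theorem cube_zero_one_ae_eq_Icc (d : ℕ) : cube (0 : Fin d → ℝ) 1 =ᵐ[volume] Set.Icc 0 1 := by
  simpa only [cube, Pi.zero_apply, zero_add] using! Measure.univ_pi_Ico_ae_eq_Icc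
    (μ := fun _ : Fin d => (volume : Measure ℝ)) (f := fun _ => 0) (g := fun _ => 1)

theorem HasLocalBound.setLIntegral_cube_le {ν : Measure (Fin d → ℝ)}
    (hf : HasLocalBound k ν A σ h₀ f) (hd : 0 < d) (hA : 0 ≤ A) (hσ : 0 ≤ σ)
    (ha : IsSubcube a h) (hh : h₀ ≤ h) (hν : ν.real (cube a h) * h ^ (2 * k) ≤ σ ^ 2) :
    ∫⁻ x in cube a h, ‖f x‖ₑ ^ criticalExponent k d
      ≤ ENNReal.ofReal ((2 * A * σ) ^ criticalExponent k d * (h ^ (2 * k))⁻¹) := by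
  have h_pos := ha.pos
  rw [← mul_rpow_criticalExponent_mul_pow hd h_pos (by positivity),
    ENNReal.ofReal_mul (by positivity), ← volume_real_cube a h_pos.le,
    ofReal_measureReal (measure_ne_top_of_subset ha.cube_subset_Icc
      isCompact_Icc.measure_lt_top.ne)]
  refine setLIntegral_enorm_rpow_le (measurableSet_cube _ _) (criticalExponent_nonneg k d)
    (by positivity) fun x hx => ?_
  rw [cube_eq_image_cube_zero_one h_pos] at hx
  obtain ⟨z, hz, rfl⟩ := hx
  exact hf.abs_le hA hσ ha hh hν (isSubcube_zero_one.cube_subset_Icc hz)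

theorem HasLocalBound.lintegral_rpow_criticalExponent_le {ν : Measure (Fin d → ℝ)}
    [IsFiniteMeasure ν] (hf : HasLocalBound k ν A σ (h₀ / 2) f) (hd : 0 < d) (hk : 0 < k)
    (hA : 0 ≤ A) (hσ : 0 < σ) (hh₀ : 0 < h₀) {D : ℝ} (hD : ν.real Set.univ = D ^ 2)
    (hν : ν.real (cube 0 1) = ν.real Set.univ) (hσD : σ ≤ D) (hDσ : D * h₀ ^ k ≤ σ) :
    ∫⁻ x in Set.Icc 0 1, ‖f x‖ₑ ^ criticalExponent k d
      ≤ ENNReal.ofReal (2 ^ (d + 1 + 2 * k) * (2 * A * σ) ^ criticalExponent k d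
          * (D / σ) ^ 2) := by
  have D_nonneg : 0 ≤ D := hσ.le.trans hσD
  have p_nonneg := criticalExponent_nonneg k d
  set p := criticalExponent k d
  set μ := (volume.restrict (Set.Icc (0 : Fin d → ℝ) 1)).withDensity fun x => ‖f x‖ₑ ^ p with μ_def
  have μ_cube {a : Fin d → ℝ} {h : ℝ} (ha : IsSubcube a h) :
      μ (cube a h) = ∫⁻ x in cube a h, ‖f x‖ₑ ^ p := by
    rw [μ_def, withDensity_apply _ (measurableSet_cube a h),
      Measure.restrict_restrict (measurableSet_cube a h), Set.inter_eq_left.2 ha.cube_subset_Icc]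
  have : IsFiniteMeasure μ := by
    refine isFiniteMeasure_withDensity ((setLIntegral_enorm_rpow_le measurableSet_Icc p_nonneg
      (B := 2 * A * σ * (D / σ) ^ ((d : ℝ) / (2 * k))) (by positivity) fun x hx => ?_).trans_lt
      (ENNReal.mul_lt_top ENNReal.ofReal_lt_top isCompact_Icc.measure_lt_top)).ne
    exact (hf.mono hA le_rfl (half_le_self hh₀.le)).abs_le_div_rpow hk hA hσ hh₀.le hD hσD hDσ hx
  have small (a : Fin d → ℝ) (h : ℝ) (ha : IsSubcube a h) (hh : h₀ / 2 ≤ h)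
      (hνh : ν.real (cube a h) * h ^ (2 * k) < σ ^ 2) :
      μ.real (cube a h) ≤ (2 * A * σ) ^ p * (h ^ (2 * k))⁻¹ := by
    have h_pos := ha.pos
    refine ENNReal.toReal_le_of_le_ofReal (by positivity) ?_
    exact (μ_cube ha).trans_le (hf.setLIntegral_cube_le hd hA hσ.le ha hh hνh.le)
  obtain ⟨m, hm⟩ := pow_unbounded_of_one_lt (1 / h₀) (one_lt_two (α := ℝ))
  have stopping := measureReal_add_le_of_stopping (by positivity) (pow_pos hσ 2) (by positivity)
    (by rw [hD, pow_mul', ← mul_pow]; gcongr) small m isSubcube_zero_one ((div_lt_iff₀ hh₀).1 hm)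
    (by rw [hν, hD, one_pow, mul_one]; gcongr)
  rw [← setLIntegral_congr (cube_zero_one_ae_eq_Icc d), ← μ_cube isSubcube_zero_one,
    ← ofReal_measureReal]
  refine ENNReal.ofReal_le_ofReal ((le_add_of_nonneg_right (by positivity)).trans
    (stopping.trans_eq ?_))
  rw [hν, hD]
  ring

end LocalBound

section Exponents

variable {d k : ℕ} {p : ℝ} {q : ℝ≥0∞}

theorem mul_toReal_inv_le_one (hp : 0 < p) (hpq : ENNReal.ofReal p ≤ q) :
    p * (q⁻¹).toReal ≤ 1 := by
  have inv_le : q⁻¹ ≤ ENNReal.ofReal p⁻¹ := by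
    rw [ENNReal.ofReal_inv_of_pos hp]
    exact ENNReal.inv_le_inv.2 hpq
  rw [← le_inv_mul_iff₀ hp, mul_one]
  exact ENNReal.toReal_le_of_le_ofReal (by positivity) inv_le

theorem eLpNorm_le_rpow_mul_eLpNorm_rpow {α E : Type*} [MeasurableSpace α] [NormedAddCommGroup E]
    {μ : Measure α} {u : α → E} {M : ℝ≥0∞} (hp : 0 < p) (hpq : ENNReal.ofReal p ≤ q) (hM : M ≠ ⊤)
    (hu : ∀ᵐ x ∂μ, ‖u x‖ₑ ≤ M) :
    eLpNorm u q μ ≤ M ^ (1 - p * (q⁻¹).toReal)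
      * eLpNorm u (ENNReal.ofReal p) μ ^ (p * (q⁻¹).toReal) := by
  rcases eq_or_ne q ⊤ with rfl | q_ne_top
  · simpa [eLpNormEssSup] using essSup_le_of_ae_le M hu
  have p_le : p ≤ q.toReal := (ENNReal.ofReal_le_iff_le_toReal q_ne_top).1 hpq
  have q_pos : 0 < q.toReal := hp.trans_le p_le
  have lintegral_le : ∫⁻ x, ‖u x‖ₑ ^ q.toReal ∂μ ≤ M ^ (q.toReal - p) * ∫⁻ x, ‖u x‖ₑ ^ p ∂μ := by
    rw [← lintegral_const_mul' _ _ (ENNReal.rpow_ne_top_of_nonneg (sub_nonneg.2 p_le) hM)]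
    refine lintegral_mono_ae ?_
    filter_upwards [hu] with x hx
    calc ‖u x‖ₑ ^ q.toReal = ‖u x‖ₑ ^ (q.toReal - p) * ‖u x‖ₑ ^ p := by
          rw [← ENNReal.rpow_add_of_nonneg _ _ (sub_nonneg.2 p_le) hp.le, sub_add_cancel]
      _ ≤ M ^ (q.toReal - p) * ‖u x‖ₑ ^ p := by gcongr
  rw [eLpNorm_eq_lintegral_rpow_enorm_toReal (ENNReal.toReal_pos_iff.1 q_pos).1.ne' q_ne_top,
    eLpNorm_eq_lintegral_rpow_enorm_toReal (ENNReal.ofReal_pos.2 hp).ne' ENNReal.ofReal_ne_top,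
    ENNReal.toReal_ofReal hp.le, ENNReal.toReal_inv, ← ENNReal.rpow_mul]
  refine (ENNReal.rpow_le_rpow lintegral_le (by positivity)).trans_eq ?_
  rw [ENNReal.mul_rpow_of_nonneg _ _ (by positivity), ← ENNReal.rpow_mul]
  congr 2 <;> field_simp

theorem eLpNorm_le_ofReal_mul_rpow {α E : Type*} [MeasurableSpace α] [NormedAddCommGroup E]
    {μ : Measure α} {u : α → E} {B β s t : ℝ} (hp : 0 < p) (hpq : ENNReal.ofReal p ≤ q)
    (hB : 0 < B) (hβ : 0 < β) (hu : ∀ᵐ x ∂μ, ‖u x‖ₑ ≤ ENNReal.ofReal (B * β ^ s))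
    (hup : eLpNorm u (ENNReal.ofReal p) μ ≤ ENNReal.ofReal (B * β ^ t)) :
    eLpNorm u q μ ≤ ENNReal.ofReal
      (B * β ^ (s * (1 - p * (q⁻¹).toReal) + t * (p * (q⁻¹).toReal))) := by
  have θ_le_one := mul_toReal_inv_le_one hp hpq
  refine (eLpNorm_le_rpow_mul_eLpNorm_rpow hp hpq ENNReal.ofReal_ne_top hu).trans ?_
  have θ_nonneg : 0 ≤ p * (q⁻¹).toReal := by positivity
  set θ := p * (q⁻¹).toReal
  refine (mul_le_mul_right (ENNReal.rpow_le_rpow hup θ_nonneg) _).trans_eq ?_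
  rw [ENNReal.ofReal_rpow_of_nonneg (by positivity) (sub_nonneg.2 θ_le_one),
    ENNReal.ofReal_rpow_of_nonneg (by positivity) θ_nonneg, ← ENNReal.ofReal_mul (by positivity)]
  congr 1
  rw [Real.mul_rpow hB.le (by positivity), Real.mul_rpow hB.le (by positivity), mul_mul_mul_comm,
    ← Real.rpow_add hB, ← Real.rpow_mul hβ.le, ← Real.rpow_mul hβ.le, ← Real.rpow_add hβ,
    sub_add_cancel, Real.rpow_one]

theorem one_le_criticalExponent (hd : 0 < d) (k : ℕ) : 1 ≤ criticalExponent k d := by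
  rw [criticalExponent, one_le_div (by positivity)]
  linarith [(Nat.cast_nonneg k : (0 : ℝ) ≤ k), (Nat.cast_nonneg d : (0 : ℝ) ≤ d)]

theorem vartheta_of_le (hq : q ≤ ENNReal.ofReal (criticalExponent k d)) :
    vartheta k d q = k / (2 * k + d) :=
  if_pos hq

theorem one_sub_two_mul_vartheta (hd : 0 < d) (hk : 0 < k)
    (hq : ENNReal.ofReal (criticalExponent k d) ≤ q) :
    1 - 2 * vartheta k d q = d / (2 * k) * (1 - criticalExponent k d * (q⁻¹).toReal)
      + d / (2 * k + d) * (criticalExponent k d * (q⁻¹).toReal) := by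
  have p_pos : 0 < criticalExponent k d := one_pos.trans_le (one_le_criticalExponent hd k)
  rcases hq.eq_or_lt with rfl | hq
  · rw [vartheta_of_le le_rfl, ← ENNReal.ofReal_inv_of_pos p_pos,
      ENNReal.toReal_ofReal (by positivity), mul_inv_cancel₀ p_pos.ne']
    field_simp
    ring
  · have vartheta_eq : vartheta k d q = (k - (d : ℝ) / 2 + d * (q⁻¹).toReal) / (2 * k) :=
      if_neg hq.not_ge
    rw [vartheta_eq, criticalExponent]
    field_simp
    ring

theorem two_mul_vartheta_mem_Icc (hd : 0 < d) (hk : (d : ℝ) / 2 < k) (q : ℝ≥0∞) :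
    2 * vartheta k d q ∈ Set.Icc (0 : ℝ) 1 := by
  have k_pos : 0 < k := by exact_mod_cast (by positivity : (0 : ℝ) ≤ d / 2).trans_lt hk
  wlog hq : ENNReal.ofReal (criticalExponent k d) ≤ q generalizing q
  · rw [vartheta_of_le (not_le.1 hq).le, ← vartheta_of_le (le_refl (ENNReal.ofReal _))]
    exact this _ le_rfl
  have p_pos : 0 < criticalExponent k d := one_pos.trans_le (one_le_criticalExponent hd k)
  have θ_le_one := mul_toReal_inv_le_one p_pos hq
  have θ_nonneg : 0 ≤ criticalExponent k d * (q⁻¹).toReal := by positivity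
  have mem_Icc : 1 - 2 * vartheta k d q ∈ Set.Icc (0 : ℝ) 1 := by
    rw [one_sub_two_mul_vartheta hd k_pos hq, mul_comm (_ / _), mul_comm (_ / _)]
    refine convex_Icc 0 1 ⟨by positivity, ?_⟩ ⟨by positivity, ?_⟩ (sub_nonneg.2 θ_le_one) θ_nonneg
      (sub_add_cancel _ _) <;>
    · rw [div_le_one (by positivity)]
      linarith
  exact ⟨by linarith [mem_Icc.2], by linarith [mem_Icc.1]⟩

end Exponents

section NormBound

variable {d k : ℕ} {A σ h₀ D κ N : ℝ} {f : (Fin d → ℝ) → ℝ} {ν : Measure (Fin d → ℝ)}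
  [IsFiniteMeasure ν]

instance isProbabilityMeasure_restrict_Icc_zero_one :
    IsProbabilityMeasure (volume.restrict (Set.Icc (0 : Fin d → ℝ) 1)) :=
  ⟨by simp [volume_Icc_zero_one]⟩

theorem HasLocalBound.eLpNorm_criticalExponent_le (hf : HasLocalBound k ν A σ (h₀ / 2) f)
    (hd : 0 < d) (hk : 0 < k) (hA : 0 ≤ A) (hσ : 0 < σ) (hh₀ : 0 < h₀)
    (hD : ν.real Set.univ = D ^ 2) (hν : ν.real (cube 0 1) = ν.real Set.univ) (hσD : σ ≤ D)
    (hDσ : D * h₀ ^ k ≤ σ) :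
    eLpNorm f (ENNReal.ofReal (criticalExponent k d)) (volume.restrict (Set.Icc 0 1))
      ≤ ENNReal.ofReal
        (2 ^ (d + 1 + 2 * k) * (2 * A * σ) * (D / σ) ^ ((d : ℝ) / (2 * k + d))) := by
  have D_pos : 0 < D := hσ.trans_le hσD
  have p_ge_one := one_le_criticalExponent hd k
  have p_pos := one_pos.trans_le p_ge_one
  have β_rpow : ((D / σ) ^ ((d : ℝ) / (2 * k + d))) ^ criticalExponent k d = (D / σ) ^ 2 := by
    rw [← Real.rpow_mul (by positivity), ← Real.rpow_natCast, criticalExponent]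
    congr 1
    push_cast
    field_simp
    ring
  rw [eLpNorm_eq_lintegral_rpow_enorm_toReal (ENNReal.ofReal_pos.2 p_pos).ne'
    ENNReal.ofReal_ne_top, ENNReal.toReal_ofReal p_pos.le, one_div, ENNReal.rpow_inv_le_iff p_pos,
    ENNReal.ofReal_rpow_of_nonneg (by positivity) p_pos.le]
  refine (hf.lintegral_rpow_criticalExponent_le hd hk hA hσ hh₀ hD hν hσD hDσ).trans
    (ENNReal.ofReal_le_ofReal ?_)
  rw [Real.mul_rpow (x := 2 ^ (d + 1 + 2 * k) * (2 * A * σ)) (by positivity) (by positivity),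
    β_rpow, Real.mul_rpow (x := 2 ^ (d + 1 + 2 * k)) (by positivity) (by positivity)]
  gcongr
  exact Real.self_le_rpow_of_one_le (one_le_pow₀ one_le_two) p_ge_one

theorem HasLocalBound.eLpNorm_le (hf : HasLocalBound k ν A σ (h₀ / 2) f)
    (f_meas : AEStronglyMeasurable f (volume.restrict (Set.Icc 0 1)))
    (hd : 0 < d) (hk : 0 < k) (hA : 0 < A) (hσ : 0 < σ) (hh₀ : 0 < h₀)
    (hD : ν.real Set.univ = D ^ 2) (hν : ν.real (cube 0 1) = ν.real Set.univ) (hσD : σ ≤ D)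
    (hDσ : D * h₀ ^ k ≤ σ) (q : ℝ≥0∞) :
    eLpNorm f q (volume.restrict (Set.Icc 0 1)) ≤ ENNReal.ofReal (2 ^ (d + 1 + 2 * k) * (2 * A)
      * (σ ^ (2 * vartheta k d q) * D ^ (1 - 2 * vartheta k d q))) := by
  have D_pos : 0 < D := hσ.trans_le hσD
  wlog hq : ENNReal.ofReal (criticalExponent k d) ≤ q generalizing q
  · rw [vartheta_of_le (not_le.1 hq).le, ← vartheta_of_le (le_refl (ENNReal.ofReal _))]
    exact (eLpNorm_le_eLpNorm_of_exponent_le (not_le.1 hq).le f_meas).trans (this _ le_rfl)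
  have sup_le : ∀ᵐ x ∂volume.restrict (Set.Icc (0 : Fin d → ℝ) 1), ‖f x‖ₑ ≤ ENNReal.ofReal
      (2 ^ (d + 1 + 2 * k) * (2 * A * σ) * (D / σ) ^ ((d : ℝ) / (2 * k))) := by
    refine ae_restrict_of_forall_mem measurableSet_Icc fun x hx => ?_
    rw [Real.enorm_eq_ofReal_abs]
    refine ENNReal.ofReal_le_ofReal (((hf.mono hA.le le_rfl (half_le_self hh₀.le)).abs_le_div_rpow
      hk hA.le hσ hh₀.le hD hσD hDσ hx).trans ?_)
    exact mul_le_mul_of_nonneg_right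
      (le_mul_of_one_le_left (by positivity) (one_le_pow₀ one_le_two)) (by positivity)
  refine (eLpNorm_le_ofReal_mul_rpow (one_pos.trans_le (one_le_criticalExponent hd k)) hq
    (by positivity) (by positivity) sup_le
    (hf.eLpNorm_criticalExponent_le hd hk hA.le hσ hh₀ hD hν hσD hDσ)).trans_eq ?_
  rw [← one_sub_two_mul_vartheta hd hk hq, Real.div_rpow D_pos.le hσ.le,
    show 2 * vartheta k d q = 1 - (1 - 2 * vartheta k d q) by ring, Real.rpow_sub hσ,
    Real.rpow_one, sub_sub_cancel]
  congr 1
  field_simp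

theorem HasLocalBound.eLpNorm_le_of_le (hf : HasLocalBound k ν A σ 1 f) (hA : 0 ≤ A) (hσ : 0 ≤ σ)
    (hν : ν.real Set.univ ≤ σ ^ 2) (q : ℝ≥0∞) :
    eLpNorm f q (volume.restrict (Set.Icc 0 1)) ≤ ENNReal.ofReal (2 * A * σ) := by
  have abs_le (x) (hx : x ∈ Set.Icc (0 : Fin d → ℝ) 1) : ‖f x‖ ≤ 2 * A * σ := by
    simpa using hf.abs_le_of_le_one hA hσ one_pos le_rfl le_rfl (by simpa using hν) hx
  simpa using eLpNorm_le_of_ae_bound (μ := volume.restrict _) (p := q)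
    (ae_restrict_of_forall_mem measurableSet_Icc abs_le)

theorem max_rpow_mul_rpow_le {θ : ℝ} (hD : 0 < D) (hκ : 0 < κ) (hN : 0 < N)
    (hθ : θ ∈ Set.Icc (0 : ℝ) 1) :
    max σ (D * (κ / N) ^ k) ^ θ * D ^ (1 - θ)
      ≤ max 1 κ ^ k * max (max (σ ^ θ * D ^ (1 - θ)) σ) (D / N ^ (k * θ)) := by
  have one_le : 1 ≤ max 1 κ ^ k := one_le_pow₀ (le_max_left _ _)
  rcases max_choice σ (D * (κ / N) ^ k) with max_eq | max_eq <;> rw [max_eq]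
  · exact ((le_max_left _ _).trans (le_max_left _ _)).trans
      (le_mul_of_one_le_left (le_max_of_le_right (by positivity)) one_le)
  · have κ_rpow_le : κ ^ (k * θ) ≤ max 1 κ ^ k := by
      have exponent_nonneg : 0 ≤ k * θ := mul_nonneg k.cast_nonneg hθ.1
      calc κ ^ (k * θ) ≤ max 1 κ ^ (k * θ) := by
            gcongr
            exact le_max_right _ _
        _ ≤ max 1 κ ^ (k : ℝ) := by
            refine Real.rpow_le_rpow_of_exponent_le (le_max_left _ _) ?_
            exact mul_le_of_le_one_right k.cast_nonneg hθ.2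
        _ = max 1 κ ^ k := Real.rpow_natCast _ _
    calc (D * (κ / N) ^ k) ^ θ * D ^ (1 - θ) = κ ^ (k * θ) * (D / N ^ (k * θ)) := by
          rw [Real.mul_rpow hD.le (by positivity), mul_right_comm, ← Real.rpow_add hD,
            add_sub_cancel, Real.rpow_one, ← Real.rpow_natCast, ← Real.rpow_mul (by positivity),
            Real.div_rpow hκ.le hN.le]
          ring
      _ ≤ _ := by
          gcongr
          exact le_max_right _ _

theorem HasLocalBound.eLpNorm_le_max (hf : HasLocalBound k ν A σ (κ / N) f)
    (f_meas : AEStronglyMeasurable f (volume.restrict (Set.Icc 0 1))) (hd : 0 < d)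
    (hk : (d : ℝ) / 2 < k) (hA : 0 < A) (hσ : 0 ≤ σ) (hκ : 0 < κ) (hN : 2 * κ ≤ N)
    (hD₀ : 0 ≤ D) (hD : ν.real Set.univ = D ^ 2) (hν : ν.real (cube 0 1) = ν.real Set.univ)
    (q : ℝ≥0∞) :
    eLpNorm f q (volume.restrict (Set.Icc 0 1)) ≤ ENNReal.ofReal
      (2 ^ (d + 1 + 2 * k) * (2 * A) * max 1 (2 * κ) ^ k
        * max (max (σ ^ (2 * vartheta k d q) * D ^ (1 - 2 * vartheta k d q)) σ)
          (D / N ^ (k * (2 * vartheta k d q)))) := by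
  have k_pos : 0 < k := by exact_mod_cast (by positivity : (0 : ℝ) ≤ d / 2).trans_lt hk
  have N_pos : 0 < N := by linarith
  have h₀_le_one : 2 * κ / N ≤ 1 := (div_le_one N_pos).2 hN
  have half_h₀ : κ / N = 2 * κ / N / 2 := by ring
  rcases le_or_gt D σ with hDσ | hσD
  · have threshold_le : κ / N ≤ 1 := by
      rw [half_h₀]
      linarith
    refine ((hf.mono hA.le le_rfl threshold_le).eLpNorm_le_of_le hA.le hσ (by rw [hD]; gcongr)
      q).trans (ENNReal.ofReal_le_ofReal ?_)
    refine mul_le_mul ?_ ((le_max_right _ _).trans (le_max_left _ _)) hσ (by positivity)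
    rw [mul_right_comm]
    exact le_mul_of_one_le_left (by positivity) (one_le_mul_of_one_le_of_one_le
      (one_le_pow₀ one_le_two) (one_le_pow₀ (le_max_left _ _)))
  · have D_pos : 0 < D := hσ.trans_lt hσD
    have max_pos : 0 < max σ (D * (2 * κ / N) ^ k) := lt_max_of_lt_right (by positivity)
    refine ((hf.mono hA.le (le_max_left σ (D * (2 * κ / N) ^ k)) half_h₀.le).eLpNorm_le f_meas hd
      k_pos hA max_pos (by positivity) hD hν ?_ (le_max_right _ _) q).trans
      (ENNReal.ofReal_le_ofReal ?_)
    · exact max_le hσD.le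
        (mul_le_of_le_one_right D_pos.le (pow_le_one₀ (by positivity) h₀_le_one))
    · rw [mul_assoc _ (max 1 (2 * κ) ^ k)]
      refine mul_le_mul_of_nonneg_left ?_ (by positivity)
      exact max_rpow_mul_rpow_le D_pos (mul_pos two_pos hκ) N_pos (two_mul_vartheta_mem_Icc hd hk q)

end NormBound

section WeakDerivative

variable {d k : ℕ} {f u : (Fin d → ℝ) → ℝ} {g : (Fin k → Fin d) → (Fin d → ℝ) → ℝ}

theorem openCube_subset_Icc (d : ℕ) : openCube d ⊆ Set.Icc 0 1 :=
  fun _ hx => ⟨fun i => (hx i trivial).1.le, fun i => (hx i trivial).2.le⟩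

theorem gridPoint_mem_Icc {N : ℕ} (τ : Fin d → Fin N) : gridPoint N τ ∈ Set.Icc 0 1 :=
  ⟨fun _ => div_nonneg (Nat.cast_nonneg _) (Nat.cast_nonneg _),
    fun i => div_le_one_of_le₀ (Nat.cast_le.2 (τ i).is_lt.le) (Nat.cast_nonneg _)⟩

theorem derivMeasure_univ (hg : ∀ α, MemLp (g α) 2 (volume.restrict (openCube d))) :
    derivMeasure g Set.univ = ENNReal.ofReal (derivL2Norm g ^ 2) := by
  have integral_nonneg (α) : 0 ≤ ∫ z in openCube d, g α z ^ 2 :=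
    integral_nonneg fun z => sq_nonneg _
  rw [derivMeasure, withDensity_apply _ MeasurableSet.univ, Measure.restrict_univ,
    lintegral_finsetSum' _ fun α _ => (hg α).1.enorm.pow_const 2, derivL2Norm,
    Real.sq_sqrt (Finset.sum_nonneg fun α _ => integral_nonneg α),
    ENNReal.ofReal_sum_of_nonneg fun α _ => integral_nonneg α]
  refine Finset.sum_congr rfl fun α _ => ?_
  rw [ofReal_integral_eq_lintegral_ofReal (hg α).integrable_sq (ae_of_all _ fun z => sq_nonneg _)]
  refine lintegral_congr fun z => ?_
  rw [Real.enorm_eq_ofReal_abs, ← ENNReal.ofReal_pow (abs_nonneg _), sq_abs]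

theorem derivMeasure_real_cube_zero_one (g : (Fin k → Fin d) → (Fin d → ℝ) → ℝ) :
    (derivMeasure g).real (cube 0 1) = (derivMeasure g).real Set.univ := by
  refine measureReal_congr (Filter.eventuallyEq_univ.2 ?_)
  refine (withDensity_absolutelyContinuous _ _).ae_le ?_
  filter_upwards [ae_restrict_mem measurableSet_openCube] with z hz i _
  exact ⟨(hz i trivial).1.le, by simpa using (hz i trivial).2⟩

theorem HasWeakDeriv.congr_eqOn (hf : HasWeakDeriv k f g) (hfu : Set.EqOn f u (openCube d)) :
    HasWeakDeriv k u g := by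
  refine ⟨hf.1, fun α φ hφ compact supp => ?_⟩
  rw [← hf.2 α φ hφ compact supp]
  exact setIntegral_congr_fun measurableSet_openCube fun x hx => by simp only [hfu hx]

end WeakDerivative

theorem exists_eLpNorm_le_max {d k : ℕ} (hd : 0 < d) (hk : (d : ℝ) / 2 < k) {c : ℝ} (hc : 1 < c) :
    ∃ (C : ℝ) (N₀ : ℕ), 0 < C ∧ ∀ 𝓑 : Set (Set (Fin d → ℝ)), IsNormalSystem c 𝓑 → ∀ (q : ℝ≥0∞)
      (f : (Fin d → ℝ) → ℝ) (g : (Fin k → Fin d) → (Fin d → ℝ) → ℝ),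
      ContinuousOn f (Set.Icc 0 1) → HasWeakDeriv k f g →
      (∀ α, MemLp (g α) 2 (volume.restrict (openCube d))) → ∀ N : ℕ, N₀ ≤ N →
      eLpNorm f q (volume.restrict (Set.Icc 0 1)) ≤ ENNReal.ofReal (C * max (max
        ((mrNorm 𝓑 (sample N f) / √(N ^ d)) ^ (2 * vartheta k d q)
          * derivL2Norm g ^ (1 - 2 * vartheta k d q))
        (mrNorm 𝓑 (sample N f) / √(N ^ d)))
        (derivL2Norm g / (N : ℝ) ^ (k * (2 * vartheta k d q)))) := by
  obtain ⟨A, κ, hA, hκ, local_bound⟩ := exists_hasLocalBound hd hk hc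
  refine ⟨2 ^ (d + 1 + 2 * k) * (2 * A) * max 1 (2 * κ) ^ k, ⌈2 * κ⌉₊, by positivity,
    fun 𝓑 h𝓑 q f g hf hw hg N hN => ?_⟩
  have N_pos : 0 < N := (Nat.ceil_pos.2 (by positivity)).trans_le hN
  obtain ⟨F, hF⟩ := ContinuousMap.exists_restrict_eq isClosed_Icc ⟨_, hf.domRestrict⟩
  have eqOn : Set.EqOn f F (Set.Icc 0 1) := fun x hx => (DFunLike.congr_fun hF ⟨x, hx⟩).symm
  have sample_eq : sample N f = sample N F := funext fun τ => eqOn (gridPoint_mem_Icc τ)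
  have mass := derivMeasure_univ hg
  have finite : IsFiniteMeasure (derivMeasure g) := ⟨by rw [mass]; exact ENNReal.ofReal_lt_top⟩
  rw [eLpNorm_congr_ae (ae_restrict_of_forall_mem measurableSet_Icc eqOn), sample_eq]
  have hwF := hw.congr_eqOn (eqOn.mono (openCube_subset_Icc d))
  exact (local_bound 𝓑 h𝓑 F g F.continuous hwF finite N N_pos).eLpNorm_le_max
    (D := derivL2Norm g) F.continuous.aestronglyMeasurable hd hk hA
    (div_nonneg (mrNorm_nonneg _ _) (Real.sqrt_nonneg _)) hκ (Nat.ceil_le.1 hN) (Real.sqrt_nonneg _)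
    (by rw [measureReal_def, mass, ENNReal.toReal_ofReal (sq_nonneg _)])
    (derivMeasure_real_cube_zero_one g) q

theorem div_sqrt_natCast_pow_rpow {T : ℝ} (hT : 0 ≤ T) (N d : ℕ) (θ : ℝ) :
    (T / √(N ^ d)) ^ (2 * θ) = T ^ (2 * θ) / ((N ^ d : ℕ) : ℝ) ^ θ := by
  rw [Real.div_rpow hT (Real.sqrt_nonneg _), Real.sqrt_eq_rpow, ← Real.rpow_mul (by positivity),
    Nat.cast_pow]
  ring_nf

theorem natCast_pow_rpow_div {d : ℕ} (hd : 0 < d) (N : ℕ) (t : ℝ) :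
    ((N ^ d : ℕ) : ℝ) ^ (t / d) = (N : ℝ) ^ t := by
  rw [Nat.cast_pow, ← Real.rpow_natCast, ← Real.rpow_mul N.cast_nonneg, mul_div_cancel₀]
  positivity

end MultiresolutionNorm

theorem mainTheorem7_general (k d : ℕ) (hd : 0 < d) (hk : (d : ℝ) / 2 < k) (c : ℝ) (hc : 1 < c) :
    ∃ (C : ℝ) (n₀ : ℕ), 0 < C ∧
      ∀ 𝓑 : Set (Set (Fin d → ℝ)), MultiresolutionNorm.IsNormalSystem c 𝓑 →
      ∀ q : ℝ≥0∞, 0 < q →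
      ∀ (f : (Fin d → ℝ) → ℝ) (Dkf : (Fin k → Fin d) → (Fin d → ℝ) → ℝ),
        ContinuousOn f (Set.Icc 0 1) →
        MultiresolutionNorm.HasWeakDeriv k f Dkf →
        (∀ α, MemLp (Dkf α) 2 (volume.restrict (MultiresolutionNorm.openCube d))) →
      ∀ n N : ℕ, n = N ^ d → n₀ ≤ n →
        eLpNorm f q (volume.restrict (Set.Icc 0 1)) ≤
          ENNReal.ofReal (C *
            max (max
              (MultiresolutionNorm.mrNorm 𝓑 (MultiresolutionNorm.sample N f)
                  ^ (2 * MultiresolutionNorm.vartheta k d q)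
                / (n : ℝ) ^ MultiresolutionNorm.vartheta k d q
                * MultiresolutionNorm.derivL2Norm Dkf
                  ^ (1 - 2 * MultiresolutionNorm.vartheta k d q))
              (MultiresolutionNorm.mrNorm 𝓑 (MultiresolutionNorm.sample N f)
                / (n : ℝ) ^ (1 / 2 : ℝ)))
              (MultiresolutionNorm.derivL2Norm Dkf
                / (n : ℝ) ^ (2 * k * MultiresolutionNorm.vartheta k d q / d))) := by
  obtain ⟨C, N₀, hC, bound⟩ := MultiresolutionNorm.exists_eLpNorm_le_max hd hk hc
  refine ⟨C, N₀ ^ d, hC, ?_⟩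
  rintro 𝓑 h𝓑 q _ f Dkf hf hw hDkf _ N rfl hN
  have mrNorm_nonneg := MultiresolutionNorm.mrNorm_nonneg 𝓑 (MultiresolutionNorm.sample N f)
  have := bound 𝓑 h𝓑 q f Dkf hf hw hDkf N (le_of_pow_le_pow_left₀ hd.ne' (Nat.zero_le N) hN)
  rwa [MultiresolutionNorm.div_sqrt_natCast_pow_rpow mrNorm_nonneg, Real.sqrt_eq_rpow,
    ← Nat.cast_pow, mul_left_comm, ← mul_assoc, ← MultiresolutionNorm.natCast_pow_rpow_div hd N
      (2 * k * MultiresolutionNorm.vartheta k d q)] at this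

theorem mainTheorem7 (k d : ℕ) (hd : 0 < d) (hk : (d : ℝ) / 2 < k) (c : ℝ) (hc : 1 < c) :
    ∃ (C : ℝ) (n₀ : ℕ), 0 < C ∧
      ∀ 𝓑 : Set (Set (Fin d → ℝ)), MultiresolutionNorm.IsNormalSystem c 𝓑 →
      ∀ q : ℝ≥0∞, 1 ≤ q →
      ∀ (f : (Fin d → ℝ) → ℝ) (Dkf : (Fin k → Fin d) → (Fin d → ℝ) → ℝ),
        ContinuousOn f (Set.Icc 0 1) →
        MultiresolutionNorm.HasWeakDeriv k f Dkf →
        (∀ α, MemLp (Dkf α) 2 (volume.restrict (MultiresolutionNorm.openCube d))) →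
      ∀ n N : ℕ, n = N ^ d → n₀ ≤ n →
        eLpNorm f q (volume.restrict (Set.Icc 0 1)) ≤
          ENNReal.ofReal (C *
            max (max
              (MultiresolutionNorm.mrNorm 𝓑 (MultiresolutionNorm.sample N f)
                  ^ (2 * MultiresolutionNorm.vartheta k d q)
                / (n : ℝ) ^ MultiresolutionNorm.vartheta k d q
                * MultiresolutionNorm.derivL2Norm Dkf
                  ^ (1 - 2 * MultiresolutionNorm.vartheta k d q))
              (MultiresolutionNorm.mrNorm 𝓑 (MultiresolutionNorm.sample N f)
                / (n : ℝ) ^ (1 / 2 : ℝ)))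
              (MultiresolutionNorm.derivL2Norm Dkf
                / (n : ℝ) ^ (2 * k * MultiresolutionNorm.vartheta k d q / d))) := by
  obtain ⟨C, n₀, hC, bound⟩ := mainTheorem7_general k d hd hk c hc
  exact ⟨C, n₀, hC, fun 𝓑 h𝓑 q hq => bound 𝓑 h𝓑 q (one_pos.trans_le hq)⟩
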